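/- All groups are finite. A class of groups is a non-empty, isomorphism-closed family of finite groups; $\pi$ is a set of primes and $\pi'$ its complement in the set of all primes. A formation is a class closed under homomorphic images and subdirect products; $G^{\mathfrak F}$ is the smallest normal subgroup $N$ of $G$ with $G/N\in\mathfrak F$, and $\mathfrak X\circ\mathfrak F=\{G : G^{\mathfrak F}\in\mathfrak X\}$. Let $\mathfrak N$, $\mathfrak N_\pi$ and $\mathfrak G_p$ be the classes of nilpotent groups, of $\pi$-nilpotent groups (those with a normal $\pi'$-subgroup with nilpotent quotient) and of $p$-groups, and let $O_{\pi'}(G)$ be the largest normal $\pi'$-subgroup of $G$. For a formation $\mathfrak F$ and a group $G$ put: - $\mathcal N_{\pi'\mathfrak F}(G)=\bigcap_{H\le G}N_G\bigl(H^{\mathfrak F}O_{\pi'}(G)\bigr)$, $\mathcal N^0_{\pi'\mathfrak F}(G)=1$, $\mathcal N^{i}_{\pi'\mathfrak F}(G)/\mathcal N^{i-1}_{\pi'\mathfrak F}(G)=\mathcal N_{\pi'\mathfrak F}\bigl(G/\mathcal N^{i-1}_{\pi'\mathfrak F}(G)\bigr)$ for $i\ge 1$, and let $\mathcal N^\infty_{\pi'\mathfrak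 F}(G)$ be the terminal term of this ascending series. - $Z_{\pi(\mathfrak N\circ\mathfrak F)}(G)$ is the product of all normal subgroups $N$ of $G$ such that every chief factor $L/K$ of $G$ with $L\le N$ and with order divisible by some prime in $\pi$ satisfies $(L/K)\rtimes(G/C_G(L/K))\in\mathfrak N\circ\mathfrak F$ (action by conjugation). - $\mathrm{Int}_{\mathfrak X}(G)$, for a class $\mathfrak X$, is the intersection of all $\mathfrak X$-maximal subgroups of $G$, i.e. of the subgroups in $\mathfrak X$ not properly contained in another subgroup in $\mathfrak X$. **Theorem C.** Let $\pi$ be a set of primes and let $\mathfrak F$ be a formation closed under taking subgroups. Then the following are equivalent: 1. $\mathcal N^\infty_{\pi'\mathfrak F}(G)=\mathrm{Int}_{\mathfrak N_\pi\circ\mathfrak F}(G)$ for every group $G$. 2. $Z_{\pi(\mathfrak N\circ\mathfrak F)}(G)=\mathrm{Int}_{\mathfrak N_\pi\circ\mathfrak F}(G)$ for every group $G$. 3. $\mathfrak F$ satisfies the $\pi$-boundary condition (III): for every $p\in\pi$, each group that does not lie in $\mathfrak G_p\circ\mathfrak F$ but all of whose proper subgroups lie in $\mathfrak G_p\circ\mathfrak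 F$ belongs to $\mathfrak N_\pi\circ\mathfrak F$. -/

import Mathlib

universe u

/-- A class of finite groups: a property of finite groups that is invariant under isomorphism. -/
structure GroupClass : Type (u + 1) where
  Mem : ∀ (G : Type u) [Group G] [Finite G], Prop
  mem_of_mulEquiv : ∀ {G H : Type u} [Group G] [Finite G] [Group H] [Finite H],
    (G ≃* H) → Mem G → Mem H

namespace GroupClass

/-- A formation: a non-empty class of finite groups closed under homomorphic images and under
subdirect products (`G` is a subdirect product of `A` and `B` when it maps onto both and the two
kernels meet trivially). -/
structure IsFormation (F : GroupClass.{u}) : Prop where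
  nonempty : ∃ (G : Type u) (_ : Group G) (_ : Finite G), F.Mem G
  image : ∀ {G H : Type u} [Group G] [Finite G] [Group H] [Finite H] (f : G →* H),
    Function.Surjective f → F.Mem G → F.Mem H
  subdirect : ∀ {G A B : Type u} [Group G] [Finite G] [Group A] [Finite A] [Group B] [Finite B]
    (f : G →* A) (g : G →* B), Function.Surjective f → Function.Surjective g →
    f.ker ⊓ g.ker = ⊥ → F.Mem A → F.Mem B → F.Mem G

/-- Closure under subgroups. -/
def IsSubgroupClosed (F : GroupClass.{u}) : Prop :=
  ∀ (G : Type u) [Group G] [Finite G] (H : Subgroup G), F.Mem G → F.Mem H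

/-- The class of finite nilpotent groups. -/
def nilpotent : GroupClass.{u} where
  Mem G _ _ := Group.IsNilpotent G
  mem_of_mulEquiv e h := by
    have := h
    exact Group.nilpotent_of_mulEquiv e

/-- The class of finite `π`-groups: every prime divisor of the order lies in `π`. -/
def piGroups (π : Set Nat.Primes) : GroupClass.{u} where
  Mem G _ _ := ∀ p : Nat.Primes, (p : ℕ) ∣ Nat.card G → p ∈ π
  mem_of_mulEquiv e h p hp := h p (by rwa [Nat.card_congr e.toEquiv])

/-- The class of finite `π`-nilpotent groups: the extensions of a (normal) `π'`-group by a
nilpotent group. -/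
def piNilpotent (π : Set Nat.Primes) : GroupClass.{u} where
  Mem G _ _ := ∃ (N : Subgroup G) (_ : N.Normal),
    (piGroups πᶜ).Mem N ∧ nilpotent.Mem (G ⧸ N)
  mem_of_mulEquiv e h := by
    obtain ⟨N, hN, h1, h2⟩ := h
    have : (N.map e.toMonoidHom).Normal := hN.map _ e.surjective
    exact ⟨N.map e.toMonoidHom, inferInstance,
      (piGroups πᶜ).mem_of_mulEquiv (e.subgroupMap N) h1,
      nilpotent.mem_of_mulEquiv (QuotientGroup.congr N (N.map e.toMonoidHom) e rfl) h2⟩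

section Residual

variable (F : GroupClass.{u})

/-- The `F`-residual of `G`, the smallest normal subgroup with quotient in `F`
(for a formation `F` this intersection has its quotient in `F`). -/
def residual (G : Type u) [Group G] [Finite G] : Subgroup G :=
  sInf {N | ∃ _ : N.Normal, F.Mem (G ⧸ N)}

theorem residual_le_comap {G H : Type u} [Group G] [Finite G] [Group H] [Finite H] (e : G ≃* H) :
    F.residual G ≤ (F.residual H).comap (e : G →* H) := by
  rw [← Subgroup.map_le_iff_le_comap]
  refine le_sInf ?_
  rintro N ⟨hN, hF⟩
  rw [Subgroup.map_le_iff_le_comap]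
  refine sInf_le ⟨hN.comap _, ?_⟩
  refine F.mem_of_mulEquiv (QuotientGroup.congr _ _ e ?_).symm hF
  exact Subgroup.map_comap_eq_self_of_surjective e.surjective N

theorem residual_map {G H : Type u} [Group G] [Finite G] [Group H] [Finite H] (e : G ≃* H) :
    (F.residual G).map (e : G →* H) = F.residual H := by
  apply le_antisymm
  · exact Subgroup.map_le_iff_le_comap.2 (F.residual_le_comap e)
  · intro x hx
    exact ⟨e.symm x, F.residual_le_comap e.symm hx, by simp⟩

/-- The `F`-residual of a subgroup `K` of `G`, as a subgroup of `G`. -/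
def subgroupResidual {G : Type u} [Group G] [Finite G] (K : Subgroup G) : Subgroup G :=
  (F.residual K).map K.subtype

theorem subgroupResidual_map {G H : Type u} [Group G] [Finite G] [Group H] [Finite H]
    (e : G ≃* H) (K : Subgroup G) :
    (F.subgroupResidual K).map (e : G →* H) = F.subgroupResidual (K.map (e : G →* H)) := by
  have h : (F.residual K).map (e.subgroupMap K : _ →* _) =
      F.residual (K.map (e : G →* H)) := F.residual_map (e.subgroupMap K)
  rw [subgroupResidual, subgroupResidual, ← h, Subgroup.map_map, Subgroup.map_map]
  rfl

/-- The `X`-radical of `G`: the product of all normal `X`-subgroups of `G`. -/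
def radical (X : GroupClass.{u}) (G : Type u) [Group G] [Finite G] : Subgroup G :=
  sSup {N | N.Normal ∧ X.Mem N}

theorem radical_map_le (X : GroupClass.{u}) {G H : Type u} [Group G] [Finite G] [Group H]
    [Finite H] (e : G ≃* H) : (X.radical G).map (e : G →* H) ≤ X.radical H := by
  rw [Subgroup.map_le_iff_le_comap]
  refine sSup_le ?_
  rintro N ⟨hN, hX⟩
  rw [← Subgroup.map_le_iff_le_comap]
  exact le_sSup ⟨hN.map _ e.surjective, X.mem_of_mulEquiv (e.subgroupMap N) hX⟩

theorem radical_map (X : GroupClass.{u}) {G H : Type u} [Group G] [Finite G] [Group H]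
    [Finite H] (e : G ≃* H) : (X.radical G).map (e : G →* H) = X.radical H := by
  apply le_antisymm (X.radical_map_le e)
  intro x hx
  exact ⟨e.symm x, X.radical_map_le e.symm ⟨x, hx, rfl⟩, by simp⟩

end Residual

/-- The formation product `X ∘ F`: the groups whose `F`-residual lies in `X`. -/
def formationProduct (X F : GroupClass.{u}) : GroupClass.{u} where
  Mem G _ _ := X.Mem (F.residual G)
  mem_of_mulEquiv e h := by
    refine X.mem_of_mulEquiv ((e.subgroupMap _).trans (MulEquiv.subgroupCongr ?_)) h
    exact F.residual_map e

section Norm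

variable (X F : GroupClass.{u})

/-- The `X`-`F`-norm of `G`: the intersection, over all subgroups `K` of `G`, of the normalizers
of the products of the `F`-residual of `K` and the `X`-radical of `G`. -/
def norm (G : Type u) [Group G] [Finite G] : Subgroup G :=
  ⨅ K : Subgroup G,
    Subgroup.normalizer ((F.subgroupResidual K ⊔ X.radical G : Subgroup G) : Set G)

instance norm_normal (G : Type u) [Group G] [Finite G] : (norm X F G).Normal := by
  refine ⟨fun n hn g => ?_⟩
  simp only [norm, Subgroup.mem_iInf] at hn ⊢
  intro K
  have h := hn (K.map ((MulAut.conj g⁻¹ : G ≃* G) : G →* G))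
  have h2 : (F.subgroupResidual K ⊔ X.radical G).map ((MulAut.conj g⁻¹ : G ≃* G) : G →* G) =
      F.subgroupResidual (K.map ((MulAut.conj g⁻¹ : G ≃* G) : G →* G)) ⊔ X.radical G := by
    rw [Subgroup.map_sup, F.subgroupResidual_map, X.radical_map]
  have h3 := Subgroup.map_equiv_normalizer_eq (F.subgroupResidual K ⊔ X.radical G)
    (MulAut.conj g⁻¹ : G ≃* G)
  rw [← h2] at h
  replace h := h3.ge h
  obtain ⟨y, hy, hyn⟩ := h
  have : y = g * n * g⁻¹ := by
    rw [← hyn]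
    simp [mul_assoc]
  exact this ▸ hy

/-- The ascending series of `X`-`F`-norms, together with the normality of its terms: it starts
at `1`, and the quotient of consecutive terms is the `X`-`F`-norm of `G` modulo the former one. -/
def normSeriesAux (G : Type u) [Group G] [Finite G] : ℕ → {N : Subgroup G // N.Normal}
  | 0 => ⟨⊥, inferInstance⟩
  | i + 1 =>
    haveI := (normSeriesAux G i).2
    ⟨(norm X F (G ⧸ (normSeriesAux G i).1)).comap (QuotientGroup.mk' (normSeriesAux G i).1),
      inferInstance⟩

/-- The `i`-th term of the ascending series of `X`-`F`-norms of `G`. -/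
def normSeries (G : Type u) [Group G] [Finite G] (i : ℕ) : Subgroup G :=
  (normSeriesAux X F G i).1

/-- The terminal term of the ascending series of `X`-`F`-norms, that is, the union of its
terms. -/
def normInfty (G : Type u) [Group G] [Finite G] : Subgroup G :=
  ⨆ i : ℕ, normSeries X F G i

/-- The terminal term of the ascending series of `πF`-norms, where the `πF`-norm of `G` is the
intersection of the normalizers of the subgroups `K^F O_π(G)`. -/
def piNormInfty (π : Set Nat.Primes) (F : GroupClass.{u}) (G : Type u) [Group G] [Finite G] :
    Subgroup G :=
  normInfty (piGroups π) F G

end Norm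

section Hypercentre

variable {G : Type u} [Group G]

/-- `L / K` is a chief factor of `G`. -/
structure IsChiefFactor (K L : Subgroup G) : Prop where
  normal_bot : K.Normal
  normal_top : L.Normal
  lt : K < L
  eq_or_eq : ∀ M : Subgroup G, M.Normal → K ≤ M → M ≤ L → M = K ∨ M = L

/-- The group `L / K`, as a subgroup of `G / K` (used when `K ≤ L`). -/
abbrev factor (K L : Subgroup G) [K.Normal] : Subgroup (G ⧸ K) :=
  L.map (QuotientGroup.mk' K)

instance factor_normal (K L : Subgroup G) [K.Normal] [hL : L.Normal] : (factor K L).Normal :=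
  hL.map _ (QuotientGroup.mk'_surjective K)

/-- The action of `G` on `L / K` by conjugation; its kernel is `C_G(L / K)`. -/
def factorAction (K L : Subgroup G) [K.Normal] [L.Normal] : G →* MulAut (factor K L) :=
  MulAut.conjNormal.comp (QuotientGroup.mk' K)

instance semidirectProduct_finite {A B : Type u} [Group A] [Group B] [Finite A] [Finite B]
    (φ : B →* MulAut A) : Finite (A ⋊[φ] B) :=
  Finite.of_equiv _ SemidirectProduct.equivProd.symm

variable [Finite G]

/-- `L / K` is `F`-central in `G`: the semidirect product of `L / K` with `G / C_G(L / K)`,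
acting by conjugation, lies in `F`. -/
def IsCentralFactor (F : GroupClass.{u}) (K L : Subgroup G) [K.Normal] [L.Normal] : Prop :=
  F.Mem (factor K L ⋊[QuotientGroup.kerLift (factorAction K L)] (G ⧸ (factorAction K L).ker))

/-- `N` is a `πF`-hypercentral normal subgroup of `G`: all chief factors of `G` below `N` of
order divisible by some prime in `π` are `F`-central in `G`. -/
def IsHypercentral (π : Set Nat.Primes) (F : GroupClass.{u}) (N : Subgroup G) : Prop :=
  N.Normal ∧ ∀ (K L : Subgroup G) [K.Normal] [L.Normal], IsChiefFactor K L → L ≤ N →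
    (∃ p ∈ π, (p : ℕ) ∣ Nat.card (factor K L)) → IsCentralFactor F K L

/-- The `πF`-hypercentre of `G`: the product of all `πF`-hypercentral normal subgroups. -/
def hypercentre (π : Set Nat.Primes) (F : GroupClass.{u}) (G : Type u) [Group G] [Finite G] :
    Subgroup G :=
  sSup {N | IsHypercentral π F N}

end Hypercentre

/-- The intersection of all `X`-maximal subgroups of `G`. -/
def maximalInter (X : GroupClass.{u}) (G : Type u) [Group G] [Finite G] : Subgroup G :=
  sInf {U | Maximal (fun V : Subgroup G => X.Mem V) U}

/-- `G` is `S`-critical for `X`: it is not in `X` but all its proper subgroups are. -/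
def IsCritical (X : GroupClass.{u}) (G : Type u) [Group G] [Finite G] : Prop :=
  ¬ X.Mem G ∧ ∀ H : Subgroup G, H < ⊤ → X.Mem H

/-- The `π`-boundary condition (III): for every `p ∈ π`, each group that is `S`-critical for
`𝔊_p ∘ F` lies in `𝔑_π ∘ F`. -/
def BoundaryConditionIII (π : Set Nat.Primes) (F : GroupClass.{u}) : Prop :=
  ∀ p ∈ π, ∀ (G : Type u) [Group G] [Finite G],
    IsCritical ((piGroups {p}).formationProduct F) G → ((piNilpotent π).formationProduct F).Mem G

end GroupClass

/-!
For subgroup-closed `F`, a chief factor is `(𝔑 ∘ F)`-central in `G` exactly when `G^F` centralizes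
it. Going down through the chief factors of a hypercentral `N` therefore shows that `UN` lies in
`𝔑_π ∘ F` whenever `U` does, so `N` lies in every maximal `(𝔑_π ∘ F)`-subgroup; going up shows that
`N` lies in `𝒩^∞`.

Under (III), suppose that a chief factor `L / K` of order divisible by `p ∈ π` is not centralized by
`G^F`. As `L / K` is irreducible, the group induced by `G` on `L / K` is not in `𝔊_p ∘ F`. A minimal
`H ≤ G` inducing a group outside `𝔊_p ∘ F` induces a critical one, which (III) puts into `𝔑_π ∘ F`;
the kernel of `H` on `L / K` lies in the Frattini subgroup of `H`, so `H` is in `𝔑_π ∘ F` as well.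
If `L` normalizes a `p`-nilpotent overgroup `R` of `H^F`, then `O_{p'}(R)` centralizes `L / K`, so
`H^F` induces a `p`-group, a contradiction. Such an `R` exists if `L` lies in the norm of `G` or in
the intersection of the maximal `(𝔑_π ∘ F)`-subgroups.

If (III) fails for a critical group `G` and `p ∈ π`, then `G^F` has an element that is not a
`p`-element, and it acts nontrivially on some irreducible `𝔽_p G`-module `V`. In `V ⋊ G` the
subgroup `V` lies in all maximal `(𝔑_π ∘ F)`-subgroups, while the norm of `V ⋊ (G / C_G(V))` is
trivial.
-/

section SchurZassenhaus

open Subgroup MulAction MulOpposite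
open scoped Pointwise

variable {A : Type*} [Group A] {B C E : Subgroup A}

theorem map_conj_mul (B : Subgroup A) (a b : A) :
    B.map (MulAut.conj (a * b)) =
      (B.map (MulAut.conj b : A →* A)).map (MulAut.conj a : A →* A) := by
  rw [map_map, map_mul]
  rfl

theorem commutator_lt_of_isSolvable [Group.IsSolvable E] (hE : E ≠ ⊥) : ⁅E, E⁆ < E := by
  have : Nontrivial E := (nontrivial_iff_ne_bot E).2 hE
  have h := Group.IsSolvable.commutator_lt_top_of_nontrivial E
  rwa [← map_subtype_lt_map_subtype, commutator_def, map_commutator, ← MonoidHom.range_eq_map,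
    E.range_subtype] at h

theorem isComplement'_subgroupOf_of_sup_eq [E.Normal] {K : Subgroup A}
    (hB : (Nat.card B).Coprime (Nat.card E)) (hK : B ⊔ E = K) :
    IsComplement' (B.subgroupOf K) (E.subgroupOf K) := by
  have hBK : B ≤ K := hK ▸ le_sup_left
  have hEK : E ≤ K := hK ▸ le_sup_right
  refine isComplement'_of_disjoint_and_mul_eq_univ ?_ ?_
  · rw [disjoint_iff, subgroupOf, subgroupOf, ← comap_inf, (disjoint_of_coprime_natCard hB).eq_bot,
      ← subgroupOf, bot_subgroupOf]
  · rw [← mul_normal, ← subgroupOf_sup hBK hEK, hK, subgroupOf_self, coe_top]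

theorem exists_sup_eq_of_coprime_relIndex {M : Subgroup A} [E.Normal] (hEM : E ≤ M)
    (h : (Nat.card E).Coprime (E.relIndex M)) :
    ∃ B : Subgroup A, B ⊔ E = M ∧ Nat.card B = E.relIndex M := by
  rw [← Nat.card_congr (subgroupOfEquivOfLe hEM).toEquiv] at h
  obtain ⟨B, hB⟩ := exists_left_complement'_of_coprime h
  refine ⟨B.map M.subtype, ?_, ?_⟩
  · conv_lhs => rw [← map_subgroupOf_eq_of_le hEM]
    rw [← Subgroup.map_sup, hB.sup_eq_top, ← MonoidHom.range_eq_map, range_subtype]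
  · rw [card_map_of_injective M.subtype_injective, ← hB.index_eq_card, relIndex]

variable [Finite A]

theorem exists_eq_stabilizer_of_isComplement' [E.Normal] [IsMulCommutative E]
    (hE : (Nat.card E).Coprime E.index) (hB : IsComplement' B E) :
    ∃ α : E.QuotientDiff, B = stabilizer A α := by
  let T : E.LeftTransversal := ⟨B, hB⟩
  let α : E.QuotientDiff := Quotient.mk'' T
  have hα : IsComplement' E (stabilizer A α) := isComplement'_stabilizer_of_coprime hE
  refine ⟨α, eq_of_le_of_card_ge (fun b hb => ?_) ?_⟩
  · have hbT : op b⁻¹ • T = T := by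
      refine Subtype.ext (Set.ext fun x => ?_)
      change x ∈ op b⁻¹ • (B : Set A) ↔ x ∈ B
      rw [Set.mem_smul_set_iff_inv_smul_mem]
      simp [B.mul_mem_cancel_right hb]
    exact congrArg Quotient.mk'' hbT
  · rw [← hB.index_eq_card, ← hα.symm.index_eq_card]

theorem exists_eq_map_conj_of_isComplement' [E.Normal] [IsMulCommutative E]
    (hE : (Nat.card E).Coprime E.index) (hB : IsComplement' B E) (hC : IsComplement' C E) :
    ∃ e ∈ E, C = B.map (MulAut.conj e) := by
  obtain ⟨α, rfl⟩ := exists_eq_stabilizer_of_isComplement' hE hB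
  obtain ⟨β, rfl⟩ := exists_eq_stabilizer_of_isComplement' hE hC
  obtain ⟨e, he⟩ := exists_smul_eq hE α β
  have he' : (e : A) • α = β := he
  exact ⟨e, e.2, by rw [← he', stabilizer_smul_eq_stabilizer_map_conj, MulEquiv.toMonoidHom_eq_coe]⟩

theorem exists_eq_map_conj_of_sup_eq_of_isMulCommutative [E.Normal] [IsMulCommutative E]
    (hB : (Nat.card B).Coprime (Nat.card E)) (hC : (Nat.card C).Coprime (Nat.card E))
    (h : B ⊔ E = C ⊔ E) : ∃ e ∈ E, C = B.map (MulAut.conj e) := by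
  set K := C ⊔ E with hK
  have hBK : B ≤ K := h ▸ le_sup_left
  have hBc := isComplement'_subgroupOf_of_sup_eq hB h
  have hEc : (Nat.card (E.subgroupOf K)).Coprime (E.subgroupOf K).index := by
    rw [hBc.index_eq_card, Nat.card_congr (subgroupOfEquivOfLe hBK).toEquiv,
      Nat.card_congr (subgroupOfEquivOfLe (hK ▸ le_sup_right : E ≤ K)).toEquiv]
    exact hB.symm
  obtain ⟨e, he, heC⟩ :=
    exists_eq_map_conj_of_isComplement' hEc hBc (isComplement'_subgroupOf_of_sup_eq hC hK.symm)
  refine ⟨e, he, ?_⟩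
  have := congrArg (map K.subtype) heC
  rwa [map_subgroupOf_eq_of_le (hK ▸ le_sup_left), map_map,
    show K.subtype.comp (MulAut.conj e) =
      (MulAut.conj (e : A) : A →* A).comp K.subtype from rfl,
    ← map_map, map_subgroupOf_eq_of_le hBK] at this

theorem exists_eq_map_conj_of_sup_eq [hEn : E.Normal] [hE : Group.IsSolvable E]
    (hB : (Nat.card B).Coprime (Nat.card E)) (hC : (Nat.card C).Coprime (Nat.card E))
    (h : B ⊔ E = C ⊔ E) : ∃ e ∈ E, C = B.map (MulAut.conj e) := by
  induction E using WellFoundedLT.induction generalizing B hEn hE with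
  | _ E ih =>
  obtain rfl | hne := eq_or_ne E ⊥
  · refine ⟨1, one_mem _, ?_⟩
    rw [map_one]
    exact (by simpa using h.symm : C = B).trans B.map_id.symm
  let q := QuotientGroup.mk' ⁅E, E⁆
  have hlt : ⁅E, E⁆ < E := commutator_lt_of_isSolvable hne
  have hEq : (E.map q).Normal := hEn.map q (QuotientGroup.mk'_surjective _)
  have hEc : IsMulCommutative (E.map q) := by
    rw [← le_centralizer_iff_isMulCommutative, ← commutator_eq_bot_iff_le_centralizer,
      ← map_commutator, Subgroup.map_eq_bot_iff, QuotientGroup.ker_mk']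
  have hcop {D : Subgroup A} (hD : (Nat.card D).Coprime (Nat.card E)) :
      (Nat.card (D.map q)).Coprime (Nat.card (E.map q)) :=
    .of_dvd (D.card_map_dvd q) (E.card_map_dvd q) hD
  obtain ⟨_, ⟨e, he, rfl⟩, heq⟩ := exists_eq_map_conj_of_sup_eq_of_isMulCommutative
    (hcop hB) (hcop hC) (by rw [← Subgroup.map_sup, h, Subgroup.map_sup])
  have hsup : B.map (MulAut.conj e) ⊔ ⁅E, E⁆ = C ⊔ ⁅E, E⁆ := by
    have : C.map q = (B.map (MulAut.conj e)).map q := by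
      rw [heq, map_map, map_map]
      rfl
    rw [map_eq_map_iff, QuotientGroup.ker_mk'] at this
    exact this.symm
  have hcard {D : Subgroup A} (hD : (Nat.card D).Coprime (Nat.card E)) :
      (Nat.card D).Coprime (Nat.card (⁅E, E⁆ : Subgroup A)) :=
    .of_dvd_right (card_dvd_of_le hlt.le) hD
  obtain ⟨e', he', rfl⟩ := ih _ hlt (hEn := inferInstance)
    (hE := Group.isSolvable_of_isSolvable_injective (inclusion_injective hlt.le))
    (hcard (.of_dvd_left (card_map_dvd B _) hB)) (hcard hC) hsup
  exact ⟨e' * e, mul_mem (hlt.le he') he, (map_conj_mul B e' e).symm⟩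

theorem normalizer_sup_eq_top_of_coprime [E.Normal] [Group.IsSolvable E] [(B ⊔ E).Normal]
    (hB : (Nat.card B).Coprime (Nat.card E)) :
    normalizer (B : Set A) ⊔ E = ⊤ := by
  refine eq_top_iff.2 fun a _ => ?_
  have hsup : B ⊔ E = B.map (MulAut.conj a) ⊔ E := by
    conv_lhs => rw [← Normal.map_conj_eq (B ⊔ E) a, Subgroup.map_sup, Normal.map_conj_eq E]
  obtain ⟨e, he, heq⟩ := exists_eq_map_conj_of_sup_eq hB (.of_dvd_left (card_map_dvd B _) hB) hsup
  have hmem : e⁻¹ * a ∈ normalizer (B : Set A) := by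
    rw [mem_normalizer_iff_map_conj_eq, map_conj_mul, heq, ← map_conj_mul, inv_mul_cancel,
      map_one]
    exact B.map_id
  simpa using mul_mem (mem_sup_right he) (mem_sup_left (T := E) hmem)

end SchurZassenhaus

theorem card_mul_relIndex_of_le {A : Type*} [Group A] {K L : Subgroup A} (h : K ≤ L) :
    Nat.card K * K.relIndex L = Nat.card L := by
  rw [← Subgroup.relIndex_bot_left, ← Subgroup.relIndex_bot_left,
    Subgroup.relIndex_mul_relIndex _ _ _ bot_le h]

theorem mem_of_pow_mem_of_coprime {A : Type*} [Group A] {N : Subgroup A} {a : A} {m n : ℕ}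
    (hmn : m.Coprime n) (hm : a ^ m ∈ N) (hn : a ^ n ∈ N) : a ∈ N := by
  have ha : a = (a ^ m) ^ m.gcdA n * (a ^ n) ^ m.gcdB n := by
    rw [← zpow_natCast, ← zpow_natCast, ← zpow_mul, ← zpow_mul, ← zpow_add, ← Nat.gcd_eq_gcd_ab,
      hmn.gcd_eq_one, Nat.cast_one, zpow_one]
  rw [ha]
  exact mul_mem (zpow_mem hm _) (zpow_mem hn _)

theorem exists_pow_mem_of_mem_sup {A : Type*} [Group A] {p : ℕ} {B E : Subgroup A} [B.Normal]
    (hE : IsPGroup p E) {a : A} (ha : a ∈ B ⊔ E) : ∃ k : ℕ, a ^ p ^ k ∈ B := by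
  obtain ⟨b, hb, e, he, rfl⟩ := Subgroup.mem_sup_of_normal_left.1 ha
  obtain ⟨k, hk⟩ := hE ⟨e, he⟩
  have hbe : ((b * e : A) : A ⧸ B) = (e : A) := by
    rw [QuotientGroup.mk_mul, (QuotientGroup.eq_one_iff b).2 hb, one_mul]
  refine ⟨k, (QuotientGroup.eq_one_iff _).1 ?_⟩
  rw [QuotientGroup.mk_pow, hbe, ← QuotientGroup.mk_pow,
    show e ^ p ^ k = 1 from congrArg Subtype.val hk, QuotientGroup.mk_one]

theorem exists_normal_isPGroup_not_dvd_relIndex {A : Type*} [Group A] [Finite A] {p : ℕ}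
    [Fact p.Prime] (K : Subgroup A) [K.Normal] [Group.IsNilpotent K] :
    ∃ E ≤ K, E.Normal ∧ IsPGroup p E ∧ ¬ p ∣ E.relIndex K := by
  let P : Sylow p K := default
  have : (P : Subgroup K).Characteristic := P.characteristic_of_normal inferInstance
  refine ⟨(P : Subgroup K).map K.subtype, Subgroup.map_subtype_le _, inferInstance,
    P.isPGroup'.map _, ?_⟩
  rw [Subgroup.relIndex, Subgroup.subgroupOf,
    Subgroup.comap_map_eq_self_of_injective K.subtype_injective]
  exact P.not_dvd_index

/-- `A` is `p`-nilpotent: it has a normal `p'`-subgroup `N` whose quotient is a `p`-group, the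
latter being expressed through the elements of `A`. -/
def IsPNilpotent (p : ℕ) (A : Type*) [Group A] : Prop :=
  ∃ N : Subgroup A, N.Normal ∧ ¬ p ∣ Nat.card N ∧ ∀ a : A, ∃ k : ℕ, a ^ p ^ k ∈ N

namespace IsPNilpotent

variable {p : ℕ} {A B : Type*} [Group A] [Group B]

theorem of_surjective (f : A →* B) (hf : Function.Surjective f) (h : IsPNilpotent p A) :
    IsPNilpotent p B := by
  obtain ⟨N, hN, hpN, hpow⟩ := h
  refine ⟨N.map f, hN.map f hf, mt (·.trans (N.card_map_dvd f)) hpN, fun b => ?_⟩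
  obtain ⟨a, rfl⟩ := hf b
  obtain ⟨k, hk⟩ := hpow a
  exact ⟨k, map_pow f a (p ^ k) ▸ Subgroup.mem_map_of_mem f hk⟩

theorem of_le_normalizer [Finite A] {S Q : Subgroup A}
    (hS : S ≤ Subgroup.normalizer (Q : Set A)) (hQ : ¬ p ∣ Nat.card Q)
    (hpow : ∀ a ∈ S, ∃ k : ℕ, a ^ p ^ k ∈ Q) : IsPNilpotent p S :=
  ⟨Q.subgroupOf S, Subgroup.normal_subgroupOf_of_le_normalizer hS,
    mt (·.trans (Q.card_comap_dvd_of_injective _ S.subtype_injective)) hQ, fun a => hpow a a.2⟩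

variable [hp : Fact p.Prime]

theorem exists_le_normalizer {S : Subgroup A} (h : IsPNilpotent p S) :
    ∃ Q ≤ S, Subgroup.normalizer (S : Set A) ≤ Subgroup.normalizer (Q : Set A) ∧
      ¬ p ∣ Nat.card Q ∧ ∀ a ∈ S, ∃ k : ℕ, a ^ p ^ k ∈ Q := by
  obtain ⟨N, -, hpN, hpow⟩ := h
  refine ⟨N.map S.subtype, Subgroup.map_subtype_le N, Subgroup.le_normalizer_iff.2 ?_,
    mt (·.trans (N.card_map_dvd _)) hpN, fun a ha => ?_⟩
  · rintro g hg _ ⟨n, hn, rfl⟩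
    have hgn : g * n * g⁻¹ ∈ S := (Subgroup.mem_normalizer_iff.1 hg n).1 n.2
    obtain ⟨k, hk⟩ := hpow ⟨_, hgn⟩
    have hn1 : (n : A) ^ Nat.card N = 1 :=
      congrArg (fun x : N => ((x : S) : A)) (pow_card_eq_one' (x := (⟨n, hn⟩ : N)))
    have hgn1 : (⟨_, hgn⟩ : S) ^ Nat.card N = 1 := Subtype.ext (by simp [conj_pow, hn1])
    refine ⟨⟨_, hgn⟩, mem_of_pow_mem_of_coprime ?_ (hgn1 ▸ N.one_mem) hk, rfl⟩
    exact ((hp.out.coprime_iff_not_dvd.2 hpN).pow_left k).symm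
  · obtain ⟨k, hk⟩ := hpow ⟨a, ha⟩
    exact ⟨k, _, hk, rfl⟩

theorem not_dvd_card_comap [Finite A] {f : A →* B} (hf : ¬ p ∣ Nat.card f.ker) {N : Subgroup B}
    (hN : ¬ p ∣ Nat.card N) : ¬ p ∣ Nat.card (N.comap f) := by
  have hcard : Nat.card f.ker * Nat.card ((N.comap f).map f) = Nat.card (N.comap f) := by
    rw [← Subgroup.relIndex_ker, card_mul_relIndex_of_le (f.ker_le_comap N)]
  rw [← hcard, hp.out.dvd_mul]
  exact not_or.2 ⟨hf, mt (·.trans (Subgroup.card_dvd_of_le (Subgroup.map_comap_le f N))) hN⟩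

theorem of_not_dvd_card_ker [Finite A] (f : A →* B) (hf : ¬ p ∣ Nat.card f.ker)
    (h : IsPNilpotent p B) : IsPNilpotent p A := by
  obtain ⟨N, hN, hpN, hpow⟩ := h
  refine ⟨N.comap f, hN.comap f, not_dvd_card_comap hf hpN, fun a => ?_⟩
  obtain ⟨k, hk⟩ := hpow (f a)
  exact ⟨k, by rwa [← map_pow] at hk⟩

theorem of_injective [Finite A] (f : A →* B) (hf : Function.Injective f) (h : IsPNilpotent p B) :
    IsPNilpotent p A :=
  h.of_not_dvd_card_ker f (by simpa [(f.ker_eq_bot_iff).2 hf] using hp.out.ne_one)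

theorem of_isPGroup (h : IsPGroup p A) : IsPNilpotent p A :=
  ⟨⊥, inferInstance, by simpa using hp.out.ne_one, fun a => (h a).imp fun k hk => by simpa using hk⟩

theorem of_map_of_isNilpotent_ker [Finite A] (f : A →* B) [Group.IsNilpotent f.ker]
    (hf : ∀ C : Subgroup A, Subgroup.normalizer (C : Set A) ⊔ f.ker = ⊤ → C.Normal)
    {R : Subgroup A} [R.Normal] (h : IsPNilpotent p (R.map f)) : IsPNilpotent p R := by
  obtain ⟨Q, -, hRQ, hpQ, hpow⟩ := h.exists_le_normalizer
  obtain ⟨E, hE, _, hEp, hEf⟩ := exists_normal_isPGroup_not_dvd_relIndex (p := p) f.ker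
  let M : Subgroup A := Q.comap f
  have hEM : E ≤ M := hE.trans (f.ker_le_comap Q)
  have hM : M.Normal := by
    refine Subgroup.normalizer_eq_top_iff.1 (top_le_iff.1 fun a _ => ?_)
    refine Subgroup.le_normalizer_comap f (hRQ (Subgroup.le_normalizer_map f ⟨a, ?_, rfl⟩))
    rw [Subgroup.normalizer_eq_top]
    trivial
  have hpM : ¬ p ∣ E.relIndex M := by
    rw [← E.relIndex_mul_relIndex _ M hE (f.ker_le_comap Q), hp.out.dvd_mul, not_or,
      Subgroup.relIndex_ker]
    exact ⟨hEf, mt (·.trans (Subgroup.card_dvd_of_le (Subgroup.map_comap_le f Q))) hpQ⟩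
  have hcop : (E.relIndex M).Coprime (Nat.card E) := by
    obtain ⟨n, hn⟩ := hEp.exists_card_eq
    exact hn ▸ ((hp.out.coprime_iff_not_dvd.2 hpM).pow_left n).symm
  obtain ⟨C, hCE, hC⟩ := exists_sup_eq_of_coprime_relIndex hEM hcop.symm
  have : (C ⊔ E).Normal := hCE ▸ hM
  have := hEp.isNilpotent
  have : C.Normal := hf C <| top_le_iff.1 <|
    (normalizer_sup_eq_top_of_coprime (hC ▸ hcop)).ge.trans (sup_le_sup_left hE _)
  refine of_le_normalizer (Q := C) ?_ (hC ▸ hpM) fun a ha => ?_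
  · rw [Subgroup.normalizer_eq_top]
    exact le_top
  · obtain ⟨k, hk⟩ := hpow (f a) ⟨a, ha, rfl⟩
    obtain ⟨l, hl⟩ := exists_pow_mem_of_mem_sup hEp (a := a ^ p ^ k)
      (by rwa [hCE, Subgroup.mem_comap, map_pow])
    exact ⟨k + l, by rwa [pow_add, pow_mul]⟩

open scoped IsMulCommutative in
theorem of_ker_le_center [Finite A] (f : A →* B) (hf : f.ker ≤ Subgroup.center A)
    (h : IsPNilpotent p B) : IsPNilpotent p A := by
  have : Group.IsNilpotent f.ker := Group.nilpotent_of_mulEquiv (Subgroup.subgroupOfEquivOfLe hf)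
  have : Finite ((⊤ : Subgroup A).map f) :=
    Finite.of_surjective _ (f.subgroupMap_surjective ⊤)
  have hA : IsPNilpotent p (⊤ : Subgroup A) := by
    refine of_map_of_isNilpotent_ker f (fun C hC => Subgroup.normalizer_eq_top_iff.1 ?_)
      (h.of_injective _ (Subgroup.subtype_injective _))
    rwa [sup_eq_left.2 (hf.trans (Subgroup.center_le_normalizer _))] at hC
  exact hA.of_surjective (Subgroup.topEquiv (G := A)).toMonoidHom Subgroup.topEquiv.surjective

theorem of_ker_le_frattini [Finite A] (f : A →* B) (hf : f.ker ≤ frattini A) {R : Subgroup A}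
    [R.Normal] (h : IsPNilpotent p (R.map f)) : IsPNilpotent p R := by
  have := frattini_nilpotent (G := A)
  have : Group.IsNilpotent f.ker := Group.nilpotent_of_mulEquiv (Subgroup.subgroupOfEquivOfLe hf)
  refine of_map_of_isNilpotent_ker f (fun C hC => Subgroup.normalizer_eq_top_iff.1 ?_) h
  exact frattini_nongenerating (top_le_iff.1 (hC.ge.trans (sup_le_sup_left hf _)))

theorem of_isNilpotent [Finite A] [Group.IsNilpotent A] : IsPNilpotent p A := by
  suffices Finite A → IsPNilpotent p A from this inferInstance
  refine Group.nilpotent_center_quotient_ind (P := fun A _ _ => Finite A → IsPNilpotent p A) A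
    (fun A _ _ _ => of_isPGroup (.of_subsingleton p A)) fun A _ _ ih _ => ?_
  exact (ih inferInstance).of_ker_le_center (QuotientGroup.mk' _) (QuotientGroup.ker_mk' _).le

theorem of_map_of_not_dvd_card_ker [Finite A] (f : A →* B) (hf : ¬ p ∣ Nat.card f.ker)
    {R : Subgroup A} (h : IsPNilpotent p (R.map f)) : IsPNilpotent p R := by
  refine h.of_not_dvd_card_ker (f.subgroupMap R) (mt (fun hd => hd.trans ?_) hf)
  rw [Subgroup.ker_subgroupMap]
  exact f.ker.card_comap_dvd_of_injective _ R.subtype_injective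

theorem of_map_of_ker_le_centralizer [Finite A] (f : A →* B) {R : Subgroup A}
    (hf : f.ker ≤ Subgroup.centralizer R) (h : IsPNilpotent p (R.map f)) : IsPNilpotent p R := by
  refine h.of_ker_le_center (f.subgroupMap R) ?_
  rw [Subgroup.ker_subgroupMap]
  exact fun x hx => Subgroup.mem_center_iff.2 fun y => Subtype.ext (hf hx y y.2)

end IsPNilpotent

namespace GroupClass

section Residual

variable {F : GroupClass.{u}} {G H : Type u} [Group G] [Finite G] [Group H] [Finite H]

theorem IsFormation.mem_of_subsingleton (hF : F.IsFormation) (G : Type u) [Group G] [Finite G]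
    [Subsingleton G] : F.Mem G := by
  obtain ⟨H, _, _, hH⟩ := hF.nonempty
  exact hF.image (1 : H →* G) (fun x => ⟨1, Subsingleton.elim _ _⟩) hH

instance residual_normal (F : GroupClass.{u}) (G : Type u) [Group G] [Finite G] :
    (F.residual G).Normal :=
  ⟨fun n hn g => by
    rw [← F.residual_map (MulAut.conj g)]
    exact ⟨n, hn, rfl⟩⟩

theorem IsFormation.infClosed (hF : F.IsFormation) (G : Type u) [Group G] [Finite G] :
    InfClosed {N : Subgroup G | ∃ _ : N.Normal, F.Mem (G ⧸ N)} := by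
  rintro M ⟨hM, hMF⟩ N ⟨hN, hNF⟩
  have hMk : M ⊓ N ≤ (QuotientGroup.mk' M).ker := inf_le_left.trans (QuotientGroup.ker_mk' M).ge
  have hNk : M ⊓ N ≤ (QuotientGroup.mk' N).ker := inf_le_right.trans (QuotientGroup.ker_mk' N).ge
  refine ⟨inferInstance, hF.subdirect (QuotientGroup.lift _ _ hMk) (QuotientGroup.lift _ _ hNk)
    (QuotientGroup.lift_surjective_of_surjective _ _ (QuotientGroup.mk'_surjective M) _)
    (QuotientGroup.lift_surjective_of_surjective _ _ (QuotientGroup.mk'_surjective N) _)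
    (eq_bot_iff.2 fun x hx => ?_) hMF hNF⟩
  obtain ⟨g, rfl⟩ := QuotientGroup.mk_surjective x
  exact (QuotientGroup.eq_one_iff g).2
    ⟨(QuotientGroup.eq_one_iff g).1 hx.1, (QuotientGroup.eq_one_iff g).1 hx.2⟩

theorem IsFormation.mem_quotient_residual (hF : F.IsFormation) (G : Type u) [Group G]
    [Finite G] : F.Mem (G ⧸ F.residual G) := by
  have : Subsingleton (G ⧸ (⊤ : Subgroup G)) := QuotientGroup.subsingleton_quotient_top
  obtain ⟨_, h⟩ := (hF.infClosed G).sInf_mem (Set.toFinite _)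
    ⟨inferInstance, hF.mem_of_subsingleton (G ⧸ (⊤ : Subgroup G))⟩ subset_rfl
  exact h

theorem IsFormation.mem_of_residual_le_ker (hF : F.IsFormation) (f : G →* H)
    (hf : Function.Surjective f) (h : F.residual G ≤ f.ker) : F.Mem H :=
  hF.image (QuotientGroup.lift (F.residual G) f h)
    (QuotientGroup.lift_surjective_of_surjective _ _ hf _) (hF.mem_quotient_residual G)

theorem IsSubgroupClosed.residual_le_ker (hS : F.IsSubgroupClosed) (f : G →* H) (h : F.Mem H) :
    F.residual G ≤ f.ker :=
  sInf_le ⟨inferInstance, F.mem_of_mulEquiv (QuotientGroup.quotientKerEquivRange f).symm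
    (hS H f.range h)⟩

theorem IsFormation.map_residual_le (hF : F.IsFormation) (hS : F.IsSubgroupClosed)
    (f : G →* H) : (F.residual G).map f ≤ F.residual H := by
  have := hS.residual_le_ker ((QuotientGroup.mk' (F.residual H)).comp f)
    (hF.mem_quotient_residual H)
  rwa [← MonoidHom.comap_ker, QuotientGroup.ker_mk', ← Subgroup.map_le_iff_le_comap] at this

theorem IsFormation.map_residual (hF : F.IsFormation) (hS : F.IsSubgroupClosed)
    (f : G →* H) (hf : Function.Surjective f) : (F.residual G).map f = F.residual H := by
  refine le_antisymm (hF.map_residual_le hS f) ?_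
  have hn : ((F.residual G).map f).Normal := Subgroup.Normal.map inferInstance f hf
  refine sInf_le ⟨hn, hF.mem_of_residual_le_ker ((QuotientGroup.mk' _).comp f)
    ((QuotientGroup.mk'_surjective _).comp hf) ?_⟩
  rw [← MonoidHom.comap_ker, QuotientGroup.ker_mk']
  exact Subgroup.le_comap_map f _

theorem IsFormation.map_subgroupResidual (hF : F.IsFormation) (hS : F.IsSubgroupClosed)
    (f : G →* H) (K : Subgroup G) :
    (F.subgroupResidual K).map f = F.subgroupResidual (K.map f) := by
  rw [subgroupResidual, subgroupResidual,
    ← hF.map_residual hS (f.subgroupMap K) (f.subgroupMap_surjective K),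
    Subgroup.map_map, Subgroup.map_map]
  rfl

theorem subgroupResidual_le (F : GroupClass.{u}) (K : Subgroup G) : F.subgroupResidual K ≤ K :=
  Subgroup.map_subtype_le _

theorem subgroupResidual_top (F : GroupClass.{u}) (G : Type u) [Group G] [Finite G] :
    F.subgroupResidual (⊤ : Subgroup G) = F.residual G :=
  F.residual_map (Subgroup.topEquiv : (⊤ : Subgroup G) ≃* G)

theorem IsFormation.subgroupResidual_range (hF : F.IsFormation) (hS : F.IsSubgroupClosed)
    (f : G →* H) : F.subgroupResidual f.range = (F.residual G).map f := by
  rw [f.range_eq_map, ← hF.map_subgroupResidual hS, subgroupResidual_top]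

theorem IsFormation.subgroupResidual_mono (hF : F.IsFormation) (hS : F.IsSubgroupClosed)
    {K L : Subgroup G} (h : K ≤ L) : F.subgroupResidual K ≤ F.subgroupResidual L := by
  have := Subgroup.map_mono (f := L.subtype) (hF.map_residual_le hS (Subgroup.inclusion h))
  rwa [Subgroup.map_map] at this

theorem IsFormation.subgroupResidual_le_residual (hF : F.IsFormation) (hS : F.IsSubgroupClosed)
    (K : Subgroup G) : F.subgroupResidual K ≤ F.residual G :=
  F.subgroupResidual_top G ▸ hF.subgroupResidual_mono hS le_top

theorem le_normalizer_subgroupResidual (F : GroupClass.{u}) (K : Subgroup G) :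
    K ≤ Subgroup.normalizer (F.subgroupResidual K : Set G) := by
  rw [← Subgroup.normal_subgroupOf_iff_le_normalizer (F.subgroupResidual_le K), subgroupResidual,
    Subgroup.subgroupOf, Subgroup.comap_map_eq_self_of_injective K.subtype_injective]
  infer_instance

end Residual

section Classes

variable {π : Set Nat.Primes} {F : GroupClass.{u}} {G H : Type u} [Group G] [Finite G] [Group H]
  [Finite H]

theorem piGroups_singleton_mem_iff (p : Nat.Primes) : (piGroups {p}).Mem G ↔ IsPGroup p G := by
  have := Fact.mk p.2
  refine ⟨fun h => IsPGroup.iff_card.2 ⟨_, Nat.eq_prime_pow_of_unique_prime_dvd Nat.card_pos.ne'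
    fun {d} hd hdG => congrArg Subtype.val (h ⟨d, hd⟩ hdG)⟩, fun h q hq => ?_⟩
  obtain ⟨n, hn⟩ := IsPGroup.iff_card.1 h
  exact Subtype.ext ((Nat.prime_dvd_prime_iff_eq q.2 p.2).1 (q.2.dvd_of_dvd_pow (hn ▸ hq)))

theorem piGroups_mem_bot : (piGroups π).Mem (⊥ : Subgroup G) := fun p hp =>
  absurd (Nat.dvd_one.1 (Subgroup.card_bot (G := G) ▸ hp)) p.2.ne_one

theorem piGroups_mem_sup {K L : Subgroup G} [L.Normal] (hK : (piGroups π).Mem K)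
    (hL : (piGroups π).Mem L) : (piGroups π).Mem (K ⊔ L : Subgroup G) := by
  intro p hp
  rw [← card_mul_relIndex_of_le (le_sup_right : L ≤ K ⊔ L), Subgroup.relIndex_sup_right,
    p.2.dvd_mul] at hp
  exact hp.elim (hL p) fun h => hK p (h.trans (Subgroup.relIndex_dvd_card L K))

theorem piGroups_mem_map {K : Subgroup G} (f : G →* H) (hK : (piGroups π).Mem K) :
    (piGroups π).Mem (K.map f) :=
  fun p hp => hK p (hp.trans (K.card_map_dvd f))

instance radical_normal (X : GroupClass.{u}) (G : Type u) [Group G] [Finite G] :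
    (X.radical G).Normal :=
  ⟨fun n hn g => by
    rw [← X.radical_map (MulAut.conj g)]
    exact ⟨n, hn, rfl⟩⟩

theorem piGroups_radical_mem (π : Set Nat.Primes) (G : Type u) [Group G] [Finite G] :
    (piGroups π).Mem ((piGroups π).radical G) := by
  have h : SupClosed {N : Subgroup G | N.Normal ∧ (piGroups π).Mem N} := by
    rintro M ⟨_, hM⟩ N ⟨_, hN⟩
    exact ⟨inferInstance, piGroups_mem_sup hM hN⟩
  exact (h.sSup_mem (Set.toFinite _) ⟨inferInstance, piGroups_mem_bot⟩ subset_rfl).2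

theorem nilpotent_isFormation : nilpotent.{u}.IsFormation where
  nonempty := ⟨PUnit, inferInstance, inferInstance, Group.isNilpotent_of_subsingleton⟩
  image f hf h := by
    have : Group.IsNilpotent _ := h
    exact Group.nilpotent_of_surjective f hf
  subdirect f g _ _ hfg hA hB := by
    have : Group.IsNilpotent _ := hA
    have : Group.IsNilpotent _ := hB
    refine Subgroup.isNilpotent_of_ker_le_center (f.prod g) ?_
    rw [MonoidHom.ker_prod, hfg]
    exact bot_le

theorem piNilpotent_mem_iff : (piNilpotent π).Mem G ↔ ∀ p ∈ π, IsPNilpotent p G := by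
  refine ⟨?_, fun h => ⟨nilpotent.residual G, inferInstance, fun p hp hpπ => ?_,
    nilpotent_isFormation.mem_quotient_residual G⟩⟩
  · rintro ⟨N, hN, hNπ, hnil⟩ p hp
    have := Fact.mk p.2
    have : Group.IsNilpotent (G ⧸ N) := hnil
    refine IsPNilpotent.of_isNilpotent.of_not_dvd_card_ker (QuotientGroup.mk' N) fun h => ?_
    exact hNπ p (QuotientGroup.ker_mk' N ▸ h) hp
  · have := Fact.mk p.2
    obtain ⟨M, hM, hpM, hpow⟩ := h p hpπ
    have hpG : IsPGroup p (G ⧸ M) := fun x => by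
      obtain ⟨g, rfl⟩ := QuotientGroup.mk_surjective x
      obtain ⟨k, hk⟩ := hpow g
      exact ⟨k, (QuotientGroup.eq_one_iff _).2 hk⟩
    have hle : nilpotent.residual G ≤ M := sInf_le ⟨hM, hpG.isNilpotent⟩
    exact hpM (hp.trans (Subgroup.card_dvd_of_le hle))

theorem formationProduct_mem_subgroup_iff (X F : GroupClass.{u}) (K : Subgroup G) :
    (X.formationProduct F).Mem K ↔ X.Mem (F.subgroupResidual K) :=
  let e := (F.residual K).equivMapOfInjective K.subtype K.subtype_injective
  ⟨X.mem_of_mulEquiv e, X.mem_of_mulEquiv e.symm⟩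

theorem piNilpotent_formationProduct_mem_iff {K : Subgroup G} :
    ((piNilpotent π).formationProduct F).Mem K ↔
      ∀ p ∈ π, IsPNilpotent p (F.subgroupResidual K) :=
  (formationProduct_mem_subgroup_iff _ F K).trans piNilpotent_mem_iff

theorem piGroups_formationProduct_mem_iff {p : Nat.Primes} {K : Subgroup G} :
    ((piGroups {p}).formationProduct F).Mem K ↔ IsPGroup p (F.subgroupResidual K) :=
  (formationProduct_mem_subgroup_iff _ F K).trans (piGroups_singleton_mem_iff p)

theorem IsFormation.piNilpotent_formationProduct_map (hF : F.IsFormation)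
    (hS : F.IsSubgroupClosed) (f : G →* H) {K : Subgroup G}
    (h : ((piNilpotent π).formationProduct F).Mem K) :
    ((piNilpotent π).formationProduct F).Mem (K.map f) := by
  rw [piNilpotent_formationProduct_mem_iff] at h ⊢
  intro p hp
  rw [← hF.map_subgroupResidual hS]
  exact (h p hp).of_surjective (f.subgroupMap _) (f.subgroupMap_surjective _)

end Classes

end GroupClass

/-- The group `V` is irreducible under the action `ρ` of `G` by automorphisms: it has no invariant
subgroups other than `1` and `V` (so `V = 1` is allowed). -/
def ActsIrreducibly {G V : Type*} [Group G] [Group V] (ρ : G →* MulAut V) : Prop :=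
  ∀ B : Subgroup V, (∀ g, ∀ b ∈ B, ρ g b ∈ B) → B = ⊥ ∨ B = ⊤

namespace ActsIrreducibly

theorem eq_bot_of_normal {G : Type*} {V : Type u} [Group G] [Group V] [Finite V]
    {ρ : G →* MulAut V} (h : ActsIrreducibly ρ) (p : Nat.Primes) (hp : (p : ℕ) ∣ Nat.card V)
    {B : Subgroup V} (hB : B.Normal) (hBp : ¬ (p : ℕ) ∣ Nat.card B) : B = ⊥ := by
  let X := GroupClass.piGroups.{u} {p}ᶜ
  have hBX : B ≤ X.radical V := le_sSup ⟨hB, fun q hq hqp => hBp (by rwa [← hqp])⟩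
  obtain hbot | htop := h (X.radical V) fun g b hb => X.radical_map (ρ g) ▸ ⟨b, hb, rfl⟩
  · exact eq_bot_iff.2 (hBX.trans hbot.le)
  · have hV : (p : ℕ) ∣ Nat.card (X.radical V) := by rwa [htop, Subgroup.card_top]
    exact absurd rfl (GroupClass.piGroups_radical_mem {p}ᶜ V p hV)

variable {G V : Type*} [Group G] [Group V] [Finite V] {ρ : G →* MulAut V}

theorem le_ker_of_isPGroup (h : ActsIrreducibly ρ) {p : ℕ} [Fact p.Prime] (hp : p ∣ Nat.card V)
    {N : Subgroup G} (hN : N.Normal) (hNp : IsPGroup p (N.map ρ)) : N ≤ ρ.ker := by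
  let B : Subgroup V := FixedPoints.subgroup (N.map ρ) V
  have hB {v : V} : v ∈ B ↔ ∀ n ∈ N, ρ n v = v :=
    ⟨fun hv n hn => hv ⟨ρ n, n, hn, rfl⟩, by rintro hv ⟨_, n, hn, rfl⟩; exact hv n hn⟩
  have hBi := h B fun g b hb => hB.2 fun n hn => by
    have hgn : n * g = g * (g⁻¹ * n * g) := by group
    rw [← MulAut.mul_apply, ← map_mul, hgn, map_mul, MulAut.mul_apply,
      hB.1 hb _ (by simpa using hN.conj_mem n hn g⁻¹)]
  have hne : B ≠ ⊥ := by
    obtain ⟨b, hb, hb1⟩ := hNp.exists_fixed_point_of_prime_dvd_card_of_fixed_point V hp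
      (a := 1) (fun x => map_one (x : MulAut V))
    exact fun hbot => hb1 ((Subgroup.mem_bot.1 (hbot ▸ (hb : b ∈ B))).symm)
  intro n hn
  ext v
  exact hB.1 (hBi.resolve_left hne ▸ Subgroup.mem_top v) n hn

end ActsIrreducibly

namespace GroupClass

section Factor

variable {G : Type u} [Group G] {K L : Subgroup G} [K.Normal] [L.Normal]

theorem coe_factorAction_mk (g : G) {l : G} (hl : QuotientGroup.mk' K l ∈ factor K L) :
    ((factorAction K L g ⟨QuotientGroup.mk' K l, hl⟩ : factor K L) : G ⧸ K) =
      QuotientGroup.mk' K (g * l * g⁻¹) := by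
  simp [factorAction, MulAut.conjNormal_apply]

open scoped commutatorElement in
theorem mem_ker_factorAction {g : G} :
    g ∈ (factorAction K L).ker ↔ ∀ l ∈ L, ⁅g, l⁆ ∈ K := by
  have key (l : G) : QuotientGroup.mk' K (g * l * g⁻¹) = QuotientGroup.mk' K l ↔ ⁅g, l⁆ ∈ K := by
    rw [← mul_inv_eq_one, ← map_inv, ← map_mul, ← MonoidHom.mem_ker, QuotientGroup.ker_mk',
      commutatorElement_def]
  refine ⟨fun hg l hl => (key l).1 ?_, fun hg => MonoidHom.mem_ker.2 ?_⟩
  · rw [← coe_factorAction_mk g ⟨l, hl, rfl⟩, MonoidHom.mem_ker.1 hg]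
    rfl
  · ext ⟨_, l, hl, rfl⟩
    exact (coe_factorAction_mk g _).trans ((key l).2 (hg l hl))

theorem le_ker_factorAction_iff {R : Subgroup G} :
    R ≤ (factorAction K L).ker ↔ ⁅R, L⁆ ≤ K := by
  rw [Subgroup.commutator_le]
  exact forall₂_congr fun g _ => mem_ker_factorAction

namespace IsChiefFactor

theorem actsIrreducibly (h : IsChiefFactor K L) : ActsIrreducibly (factorAction K L) := by
  intro B hB
  let q := QuotientGroup.mk' K
  let M : Subgroup G := (B.map (factor K L).subtype).comap q
  have hBM : B = (M.map q).subgroupOf (factor K L) := by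
    rw [Subgroup.map_comap_eq_self_of_surjective (QuotientGroup.mk'_surjective K),
      Subgroup.subgroupOf,
      Subgroup.comap_map_eq_self_of_injective (factor K L).subtype_injective]
  have hM : M.Normal := by
    refine ⟨?_⟩
    rintro m ⟨⟨b, hb'⟩, hb, hbm : b = q m⟩ g
    subst hbm
    exact ⟨_, hB g _ hb, coe_factorAction_mk g hb'⟩
  have hKM : K ≤ M := (QuotientGroup.ker_mk' K).ge.trans (q.ker_le_comap _)
  have hML : M ≤ L := by
    refine (Subgroup.comap_mono (Subgroup.map_subtype_le B)).trans ?_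
    rw [Subgroup.comap_map_eq_self ((QuotientGroup.ker_mk' K).trans_le h.lt.le)]
  obtain hMK | hML := h.eq_or_eq M hM hKM hML
  · left
    rw [hBM, hMK, QuotientGroup.map_mk'_self, Subgroup.bot_subgroupOf]
  · right
    rw [hBM, hML, Subgroup.subgroupOf_self]

variable [Finite G]

theorem le_ker_of_not_dvd_card (h : IsChiefFactor K L) {p : Nat.Primes}
    (hp : (p : ℕ) ∣ Nat.card (factor K L)) {Q : Subgroup G} (hQp : ¬ (p : ℕ) ∣ Nat.card Q)
    (hLQ : L ≤ Subgroup.normalizer (Q : Set G)) : Q ≤ (factorAction K L).ker := by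
  have hLn : L ≤ Subgroup.normalizer ((Q ⊓ L : Subgroup G) : Set G) :=
    (le_inf hLQ Subgroup.le_normalizer).trans Subgroup.inf_normalizer_le_normalizer_inf
  let B : Subgroup (G ⧸ K) := (Q ⊓ L).map (QuotientGroup.mk' K)
  have hB : (B.subgroupOf (factor K L)).Normal := Subgroup.normal_subgroupOf_of_le_normalizer
    ((Subgroup.map_mono hLn).trans (Subgroup.le_normalizer_map _))
  have hBp : ¬ (p : ℕ) ∣ Nat.card (B.subgroupOf (factor K L)) := fun hd => hQp <|
    (hd.trans (B.card_comap_dvd_of_injective _ (factor K L).subtype_injective)).trans <|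
      (Subgroup.card_map_dvd _ _).trans (Subgroup.card_dvd_of_le inf_le_left)
  have hbot := h.actsIrreducibly.eq_bot_of_normal p hp hB hBp
  rw [Subgroup.subgroupOf_eq_bot, disjoint_iff, inf_eq_left.2 (Subgroup.map_mono inf_le_right),
    Subgroup.map_eq_bot_iff, QuotientGroup.ker_mk'] at hbot
  refine le_ker_factorAction_iff.2 (le_trans (le_inf ?_ (Subgroup.commutator_le_right Q L)) hbot)
  refine Subgroup.commutator_le.2 fun x hx l hl => ?_
  rw [commutatorElement_def, mul_assoc, mul_assoc, ← mul_assoc l]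
  exact mul_mem hx ((Subgroup.mem_normalizer_iff.1 (hLQ hl) _).1 (inv_mem hx))

theorem isPGroup_map (h : IsChiefFactor K L) {p : Nat.Primes}
    (hp : (p : ℕ) ∣ Nat.card (factor K L)) {R : Subgroup G} (hR : IsPNilpotent p R)
    (hLR : L ≤ Subgroup.normalizer (R : Set G)) : IsPGroup p (R.map (factorAction K L)) := by
  have := Fact.mk p.2
  obtain ⟨Q, -, hRQ, hQp, hpow⟩ := hR.exists_le_normalizer
  rintro ⟨_, a, ha, rfl⟩
  obtain ⟨k, hk⟩ := hpow a ha
  refine ⟨k, Subtype.ext ?_⟩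
  simpa using h.le_ker_of_not_dvd_card hp hQp (hLR.trans hRQ) hk

end IsChiefFactor

end Factor

end GroupClass

namespace GroupClass

theorem map_subtype_lt {G : Type*} [Group G] {H : Subgroup G} {M : Subgroup H} (h : M < ⊤) :
    M.map H.subtype < H :=
  (Subgroup.map_subtype_lt_map_subtype.2 h).trans_eq
    (by rw [← MonoidHom.range_eq_map, H.range_subtype])

theorem exists_isCritical_map (X : GroupClass.{u}) {G A : Type u} [Group G] [Finite G] [Group A]
    [Finite A] (f : G →* A) (hf : ¬ X.Mem f.range) :
    ∃ H : Subgroup G, IsCritical X (H.map f) ∧ (f.comp H.subtype).ker ≤ frattini H := by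
  -- If `H` is minimal with image outside `X`, no proper subgroup of `H` supplements the kernel.
  obtain ⟨H, hH, hmin⟩ := (Set.toFinite {H : Subgroup G | ¬ X.Mem (H.map f)}).exists_minimal
    ⟨⊤, fun h => hf (f.range_eq_map ▸ h)⟩
  have hlt (M : Subgroup G) (hM : M < H) : X.Mem (M.map f) :=
    not_not.1 fun hMX => hM.not_ge (hmin hMX hM.le)
  refine ⟨H, ⟨hH, fun T hT => ?_⟩, le_iInf₂ fun M hM => ?_⟩
  · let T' : Subgroup A := T.map (H.map f).subtype
    have hT' : T' < H.map f := map_subtype_lt hT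
    have hmap : (H ⊓ T'.comap f).map f = T' :=
      le_antisymm ((Subgroup.map_mono inf_le_right).trans (Subgroup.map_comap_le f T')) fun y hy =>
        (hT'.le hy).imp fun x ⟨hx, hxy⟩ => ⟨⟨hx, show f x ∈ T' from hxy ▸ hy⟩, hxy⟩
    have hX := hlt (H ⊓ T'.comap f) <| inf_le_left.lt_of_ne fun heq =>
      hT'.ne (by rw [← hmap, heq])
    exact X.mem_of_mulEquiv ((MulEquiv.subgroupCongr hmap).trans
      (T.equivMapOfInjective _ (H.map f).subtype_injective).symm) hX
  · by_contra hle
    have hsup : M ⊔ (f.comp H.subtype).ker = ⊤ := hM.2 _ (left_lt_sup.2 hle)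
    have hmap : (M.map H.subtype).map f = H.map f := by
      have := congrArg (Subgroup.map (f.comp H.subtype)) hsup
      rwa [Subgroup.map_sup, (Subgroup.map_eq_bot_iff _).2 le_rfl, sup_bot_eq,
        ← Subgroup.map_map, ← Subgroup.map_map, ← MonoidHom.range_eq_map, H.range_subtype] at this
    exact hH (hmap ▸ hlt _ (map_subtype_lt hM.1.lt_top))

section BoundaryCondition

variable {F : GroupClass.{u}} {π : Set Nat.Primes} {G : Type u} [Group G] [Finite G]

theorem IsFormation.piNilpotent_formationProduct_mem_of_ker_le_frattini (hF : F.IsFormation)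
    (hS : F.IsSubgroupClosed) {A : Type u} [Group A] [Finite A] (f : G →* A)
    (hf : f.ker ≤ frattini G) (h : ((piNilpotent π).formationProduct F).Mem f.range) :
    ((piNilpotent π).formationProduct F).Mem G := by
  refine piNilpotent_mem_iff.2 fun p hp => ?_
  have := Fact.mk p.2
  refine IsPNilpotent.of_ker_le_frattini f hf ?_
  rw [← hF.subgroupResidual_range hS]
  exact piNilpotent_formationProduct_mem_iff.1 h p hp

theorem IsChiefFactor.residual_le_ker {K L : Subgroup G} [K.Normal] [L.Normal]
    (h : IsChiefFactor K L) (hF : F.IsFormation) (hS : F.IsSubgroupClosed)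
    (h3 : BoundaryConditionIII π F) {p : Nat.Primes} (hp : p ∈ π)
    (hpd : (p : ℕ) ∣ Nat.card (factor K L))
    (hL : ∀ H : Subgroup G, ((piNilpotent π).formationProduct F).Mem H →
      ∃ R : Subgroup G, F.subgroupResidual H ≤ R ∧ IsPNilpotent p R ∧
        L ≤ Subgroup.normalizer (R : Set G)) :
    F.residual G ≤ (factorAction K L).ker := by
  have := Fact.mk p.2
  let ρ := factorAction K L
  refine h.actsIrreducibly.le_ker_of_isPGroup hpd inferInstance ?_
  rw [← hF.subgroupResidual_range hS, ← piGroups_formationProduct_mem_iff]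
  by_contra hρ
  obtain ⟨H, hcrit, hker⟩ := exists_isCritical_map _ ρ hρ
  have hrange : (ρ.comp H.subtype).range = H.map ρ := by rw [MonoidHom.range_comp, H.range_subtype]
  have hHX : ((piNilpotent π).formationProduct F).Mem H :=
    hF.piNilpotent_formationProduct_mem_of_ker_le_frattini hS (ρ.comp H.subtype) hker
      (by rw [hrange]; exact h3 p hp _ hcrit)
  obtain ⟨R, hHR, hR, hLR⟩ := hL H hHX
  refine hcrit.1 (piGroups_formationProduct_mem_iff.2 ?_)
  rw [← hF.map_subgroupResidual hS]
  exact (h.isPGroup_map hpd hR hLR).to_le (Subgroup.map_mono hHR)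

end BoundaryCondition

end GroupClass

section Semidirect

variable {V A : Type*} [Group V] [Group A] {φ : A →* MulAut V}

instance range_inl_normal : (SemidirectProduct.inl : V →* V ⋊[φ] A).range.Normal := by
  rw [SemidirectProduct.range_inl_eq_ker_rightHom]
  infer_instance

variable (φ) in
/-- The conjugation action of `V ⋊ A` on its normal subgroup `V`. -/
def semidirectConj : V ⋊[φ] A →* MulAut V :=
  SemidirectProduct.lift MulAut.conj φ fun a => by ext; simp

theorem inl_semidirectConj_apply (x : V ⋊[φ] A) (v : V) :
    (SemidirectProduct.inl (semidirectConj φ x v) : V ⋊[φ] A) =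
      x * SemidirectProduct.inl v * x⁻¹ := by
  obtain ⟨w, a⟩ := x
  ext <;> simp [semidirectConj]

theorem ker_semidirectConj :
    (semidirectConj φ).ker =
      Subgroup.centralizer (SemidirectProduct.inl : V →* V ⋊[φ] A).range := by
  ext x
  rw [MonoidHom.mem_ker, MulEquiv.ext_iff, Subgroup.mem_centralizer_iff, MonoidHom.coe_range,
    Set.forall_mem_range]
  refine forall_congr' fun v => ?_
  rw [← (SemidirectProduct.inl_injective (φ := φ)).eq_iff, inl_semidirectConj_apply,
    mul_inv_eq_iff_eq_mul, MulAut.one_apply, eq_comm]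

namespace ActsIrreducibly

theorem disjoint_or_range_inl_le (h : ActsIrreducibly φ) (M : Subgroup (V ⋊[φ] A)) [M.Normal] :
    Disjoint M (SemidirectProduct.inl : V →* V ⋊[φ] A).range ∨
      (SemidirectProduct.inl : V →* V ⋊[φ] A).range ≤ M := by
  obtain hbot | htop := h (M.comap SemidirectProduct.inl) fun a v hv => by
    rw [Subgroup.mem_comap, SemidirectProduct.inl_aut, map_inv]
    exact Subgroup.Normal.conj_mem (H := M) inferInstance _ hv (SemidirectProduct.inr a)
  · left
    rw [Subgroup.disjoint_def]
    rintro _ hx ⟨v, rfl⟩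
    rw [Subgroup.mem_bot.1 (hbot ▸ hx : v ∈ (⊥ : Subgroup V)), map_one]
  · right
    rintro _ ⟨v, rfl⟩
    exact (htop ▸ Subgroup.mem_top v : v ∈ M.comap SemidirectProduct.inl)

theorem le_ker_semidirectConj (h : ActsIrreducibly φ) {R : Subgroup (V ⋊[φ] A)} [R.Normal]
    (hR : Group.IsNilpotent R) : R ≤ (semidirectConj φ).ker := by
  let N : Subgroup (V ⋊[φ] A) := SemidirectProduct.inl.range
  have hNR : ⁅N, R⁆ = ⊥ := by
    obtain hdis | hle := h.disjoint_or_range_inl_le ⁅N, R⁆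
    · exact disjoint_self.1 (hdis.mono_right (Subgroup.commutator_le_left N R))
    · have hN (n : ℕ) : N ≤ R.lowerCentralSeries n := by
        induction n with
        | zero => exact hle.trans (Subgroup.commutator_le_right N R)
        | succ n ih => exact hle.trans (Subgroup.commutator_mono ih le_rfl)
      obtain ⟨n, hn⟩ := Subgroup.isNilpotent_iff_lowerCentralSeries R |>.1 hR
      rw [eq_bot_iff.2 ((hN n).trans hn.le), Subgroup.commutator_bot_left]
  rw [ker_semidirectConj, ← Subgroup.commutator_eq_bot_iff_le_centralizer, Subgroup.commutator_comm]
  exact hNR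

end ActsIrreducibly

end Semidirect

namespace GroupClass

variable {F : GroupClass.{u}} {G : Type u} [Group G] {K L : Subgroup G} [K.Normal] [L.Normal]

theorem range_conj_le_range_factorAction :
    (MulAut.conj : factor K L →* MulAut (factor K L)).range ≤ (factorAction K L).range := by
  rintro _ ⟨⟨_, l, hl, rfl⟩, rfl⟩
  refine ⟨l, ?_⟩
  ext
  simp [factorAction, MulAut.conjNormal_apply]

theorem range_semidirectConj_kerLift_factorAction :
    (semidirectConj (QuotientGroup.kerLift (factorAction K L))).range =
      (factorAction K L).range := by
  apply le_antisymm
  · rintro _ ⟨⟨v, a⟩, rfl⟩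
    obtain ⟨g, rfl⟩ := QuotientGroup.mk_surjective a
    exact mul_mem (range_conj_le_range_factorAction ⟨v, rfl⟩) ⟨g, rfl⟩
  · rintro _ ⟨g, rfl⟩
    exact ⟨SemidirectProduct.inr (QuotientGroup.mk g), by simp [semidirectConj]⟩

theorem IsChiefFactor.isCentralFactor_iff [Finite G] (h : IsChiefFactor K L) (hF : F.IsFormation)
    (hS : F.IsSubgroupClosed) : IsCentralFactor (nilpotent.formationProduct F) K L ↔
      F.residual G ≤ (factorAction K L).ker := by
  let ρ := factorAction K L
  let W := factor K L ⋊[QuotientGroup.kerLift ρ] (G ⧸ ρ.ker)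
  let σ := semidirectConj (QuotientGroup.kerLift ρ)
  have hρσ : σ.range = ρ.range := range_semidirectConj_kerLift_factorAction
  have hirr : ActsIrreducibly (QuotientGroup.kerLift ρ) := fun B hB =>
    h.actsIrreducibly B fun g => hB g
  constructor
  · intro (hnil : Group.IsNilpotent (F.residual W))
    have hσ : F.Mem σ.range := hF.mem_of_residual_le_ker σ.rangeRestrict
      σ.rangeRestrict_surjective (σ.ker_rangeRestrict.symm ▸ hirr.le_ker_semidirectConj hnil)
    simpa using hS.residual_le_ker ρ.rangeRestrict (hρσ ▸ hσ)
  · intro hR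
    have hG : F.Mem (G ⧸ ρ.ker) := hF.mem_of_residual_le_ker (QuotientGroup.mk' ρ.ker)
      (QuotientGroup.mk'_surjective _) (by rwa [QuotientGroup.ker_mk'])
    have hσ : F.Mem σ.range :=
      F.mem_of_mulEquiv (MulEquiv.subgroupCongr hρσ.symm)
        (F.mem_of_mulEquiv (QuotientGroup.quotientKerEquivRange ρ) hG)
    have hcent : F.residual W ≤ Subgroup.centralizer (F.residual W) := by
      have hinl : F.residual W ≤ (SemidirectProduct.inl : factor K L →* W).range :=
        (hS.residual_le_ker SemidirectProduct.rightHom hG).trans_eq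
          SemidirectProduct.range_inl_eq_ker_rightHom.symm
      have hconj := hS.residual_le_ker σ.rangeRestrict hσ
      rw [σ.ker_rangeRestrict, ker_semidirectConj] at hconj
      exact hconj.trans (Subgroup.centralizer_le hinl)
    have : IsMulCommutative (F.residual W) := Subgroup.le_centralizer_iff_isMulCommutative.1 hcent
    change Group.IsNilpotent (F.residual W)
    open scoped IsMulCommutative in infer_instance

end GroupClass

namespace GroupClass

variable {F : GroupClass.{u}} {π : Set Nat.Primes} {G : Type u} [Group G]

theorem map_mk'_sup (U N : Subgroup G) [N.Normal] :
    (U ⊔ N).map (QuotientGroup.mk' N) = U.map (QuotientGroup.mk' N) := by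
  rw [Subgroup.map_sup, QuotientGroup.map_mk'_self, sup_bot_eq]

theorem card_factor (K L : Subgroup G) [K.Normal] : Nat.card (factor K L) = K.relIndex L := by
  rw [factor, ← Subgroup.relIndex_ker, QuotientGroup.ker_mk']

theorem factor_le_centralizer_iff {K L R : Subgroup G} [K.Normal] :
    factor K L ≤ Subgroup.centralizer (R.map (QuotientGroup.mk' K)) ↔ ⁅R, L⁆ ≤ K := by
  rw [← Subgroup.commutator_eq_bot_iff_le_centralizer, ← Subgroup.map_commutator,
    Subgroup.map_eq_bot_iff, QuotientGroup.ker_mk', Subgroup.commutator_comm]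

variable [Finite G]

theorem exists_isChiefFactor_above {M N : Subgroup G} (hM : M.Normal) (hN : N.Normal)
    (h : M < N) : ∃ L : Subgroup G, IsChiefFactor M L ∧ L ≤ N := by
  obtain ⟨L, ⟨hL, hML, hLN⟩, hmin⟩ :=
    (Set.toFinite {L : Subgroup G | L.Normal ∧ M < L ∧ L ≤ N}).exists_minimal ⟨N, hN, h, le_rfl⟩
  refine ⟨L, ⟨hM, hL, hML, fun A hA hMA hAL => ?_⟩, hLN⟩
  exact hMA.eq_or_lt.imp Eq.symm fun hlt =>
    hAL.antisymm (hmin ⟨hA, hlt, hAL.trans hLN⟩ hAL)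

theorem exists_isChiefFactor_below {M N : Subgroup G} (hM : M.Normal) (hN : N.Normal)
    (h : M < N) : ∃ K : Subgroup G, IsChiefFactor K N ∧ M ≤ K := by
  obtain ⟨K, ⟨hK, hKN, hMK⟩, hmax⟩ :=
    (Set.toFinite {K : Subgroup G | K.Normal ∧ K < N ∧ M ≤ K}).exists_maximal ⟨M, hM, h, le_rfl⟩
  refine ⟨K, ⟨hK, hN, hKN, fun A hA hKA hAN => ?_⟩, hMK⟩
  exact hAN.eq_or_lt.symm.imp_left fun hlt =>
    (hmax ⟨hA, hlt, hMK.trans hKA⟩ hKA).antisymm hKA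

section Hypercentral

theorem isHypercentral_iff (hF : F.IsFormation) (hS : F.IsSubgroupClosed) {N : Subgroup G} :
    IsHypercentral π (nilpotent.formationProduct F) N ↔ N.Normal ∧
      ∀ (K L : Subgroup G) [K.Normal] [L.Normal], IsChiefFactor K L → L ≤ N →
        (∃ p ∈ π, (p : ℕ) ∣ Nat.card (factor K L)) →
          F.residual G ≤ (factorAction K L).ker :=
  and_congr_right fun _ => forall₄_congr fun _ _ _ _ => forall_congr' fun h =>
    forall₂_congr fun _ _ => h.isCentralFactor_iff hF hS

theorem isPNilpotent_map_mk'_of_le {p : ℕ} [Fact p.Prime] {K M R : Subgroup G} [K.Normal]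
    [M.Normal] (hKM : K ≤ M)
    (h : p ∣ Nat.card (factor K M) → R ≤ (factorAction K M).ker)
    (hR : IsPNilpotent p (R.map (QuotientGroup.mk' M))) :
    IsPNilpotent p (R.map (QuotientGroup.mk' K)) := by
  let f : G ⧸ K →* G ⧸ M := QuotientGroup.map K M (MonoidHom.id G) hKM
  have hker : f.ker = factor K M := QuotientGroup.ker_map _ _ _ _
  have hf : IsPNilpotent p ((R.map (QuotientGroup.mk' K)).map f) := by
    rw [Subgroup.map_map]
    exact hR
  by_cases hd : p ∣ Nat.card (factor K M)
  · refine hf.of_map_of_ker_le_centralizer f ?_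
    rw [hker, factor_le_centralizer_iff, ← le_ker_factorAction_iff]
    exact h hd
  · exact hf.of_map_of_not_dvd_card_ker f (hker ▸ hd)

namespace IsHypercentral

theorem mem_of_map (hF : F.IsFormation) (hS : F.IsSubgroupClosed) {N : Subgroup G} [N.Normal]
    (hN : IsHypercentral π (nilpotent.formationProduct F) N) {H : Subgroup G}
    (hH : ((piNilpotent π).formationProduct F).Mem (H.map (QuotientGroup.mk' N))) :
    ((piNilpotent π).formationProduct F).Mem H := by
  have hcent := ((isHypercentral_iff hF hS).1 hN).2
  rw [piNilpotent_formationProduct_mem_iff] at hH ⊢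
  intro p hp
  have := Fact.mk p.2
  -- Descend from `N` to `1` along chief factors: the residual of `G` centralizes those of order
  -- divisible by `p`.
  let R := F.subgroupResidual H
  let S : Set (Subgroup G) :=
    {M | M ≤ N ∧ ∃ _ : M.Normal, IsPNilpotent p (R.map (QuotientGroup.mk' M))}
  obtain ⟨M, ⟨hMN, hM, hMp⟩, hmin⟩ := (Set.toFinite S).exists_minimal
    ⟨N, le_rfl, inferInstance, by rw [hF.map_subgroupResidual hS]; exact hH p hp⟩
  obtain rfl | hne := eq_or_ne M ⊥
  · refine hMp.of_map_of_not_dvd_card_ker (QuotientGroup.mk' ⊥) ?_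
    rw [QuotientGroup.ker_mk', Subgroup.card_bot]
    exact p.2.one_lt.not_ge ∘ Nat.le_of_dvd one_pos
  · obtain ⟨K, hc, -⟩ := exists_isChiefFactor_below inferInstance hM (bot_lt_iff_ne_bot.2 hne)
    have hK := hc.normal_bot
    refine absurd (hmin ⟨hc.lt.le.trans hMN, hK, ?_⟩ hc.lt.le) hc.lt.not_ge
    exact isPNilpotent_map_mk'_of_le hc.lt.le (fun hd =>
      (hF.subgroupResidual_le_residual hS H).trans (hcent K M hc hMN ⟨p, hp, hd⟩)) hMp

theorem mem_sup (hF : F.IsFormation) (hS : F.IsSubgroupClosed) {N U : Subgroup G}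
    (hN : IsHypercentral π (nilpotent.formationProduct F) N)
    (hU : ((piNilpotent π).formationProduct F).Mem U) :
    ((piNilpotent π).formationProduct F).Mem (U ⊔ N : Subgroup G) := by
  have := hN.1
  refine hN.mem_of_map hF hS ?_
  rw [map_mk'_sup]
  exact hF.piNilpotent_formationProduct_map hS _ hU

theorem mono {X : GroupClass.{u}} {M N : Subgroup G} (hN : IsHypercentral π X N)
    (hM : M.Normal) (h : M ≤ N) : IsHypercentral π X M :=
  ⟨hM, fun K L _ _ hc hL hp => hN.2 K L hc (hL.trans h) hp⟩

end IsHypercentral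

end Hypercentral

section MaximalInter

instance maximalInter_normal (X : GroupClass.{u}) (G : Type u) [Group G] [Finite G] :
    (X.maximalInter G).Normal := by
  refine ⟨fun n hn g => Subgroup.mem_sInf.2 fun U hU => ?_⟩
  let e : G ≃* G := MulAut.conj g
  refine Subgroup.mem_sInf.1 hn (U.comap (e : G →* G)) ⟨?_, fun V hV hUV => ?_⟩
  · rw [Subgroup.comap_equiv_eq_map_symm]
    exact X.mem_of_mulEquiv (e.symm.subgroupMap U) hU.1
  · refine Subgroup.map_le_iff_le_comap.1 (hU.2 (X.mem_of_mulEquiv (e.subgroupMap V) hV) ?_)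
    rw [← Subgroup.map_comap_eq_self_of_surjective (f := (e : G →* G)) e.surjective U]
    exact Subgroup.map_mono hUV

theorem le_maximalInter_of_forall_sup_mem {X : GroupClass.{u}} {N : Subgroup G}
    (h : ∀ U : Subgroup G, X.Mem U → X.Mem (U ⊔ N : Subgroup G)) : N ≤ X.maximalInter G :=
  le_sInf fun U hU => le_sup_right.trans (hU.2 (h U hU.1) le_sup_left)

theorem IsHypercentral.le_maximalInter (hF : F.IsFormation) (hS : F.IsSubgroupClosed)
    {N : Subgroup G} (hN : IsHypercentral π (nilpotent.formationProduct F) N) :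
    N ≤ ((piNilpotent π).formationProduct F).maximalInter G :=
  le_maximalInter_of_forall_sup_mem fun _ => hN.mem_sup hF hS

theorem isHypercentral_maximalInter (hF : F.IsFormation) (hS : F.IsSubgroupClosed)
    (h3 : BoundaryConditionIII π F) : IsHypercentral π (nilpotent.formationProduct F)
      (((piNilpotent π).formationProduct F).maximalInter G) := by
  rw [isHypercentral_iff hF hS]
  refine ⟨inferInstance, ?_⟩
  rintro K L _ _ hc hL ⟨p, hp, hd⟩
  refine hc.residual_le_ker hF hS h3 hp hd fun H hH => ?_
  obtain ⟨U, hHU, hU⟩ := (Set.toFinite {V : Subgroup G |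
    ((piNilpotent π).formationProduct F).Mem V}).exists_le_maximal hH
  exact ⟨F.subgroupResidual U, hF.subgroupResidual_mono hS hHU,
    piNilpotent_formationProduct_mem_iff.1 hU.1 p hp,
    (hL.trans (sInf_le hU)).trans (F.le_normalizer_subgroupResidual U)⟩

end MaximalInter

section Norm

instance normSeries_normal (X F : GroupClass.{u}) (G : Type u) [Group G] [Finite G] (i : ℕ) :
    (normSeries X F G i).Normal :=
  (normSeriesAux X F G i).2

theorem normSeries_succ (X F : GroupClass.{u}) (G : Type u) [Group G] [Finite G] (i : ℕ) :
    normSeries X F G (i + 1) = (norm X F (G ⧸ normSeries X F G i)).comap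
      (QuotientGroup.mk' (normSeries X F G i)) := rfl

theorem normSeries_mono (X F : GroupClass.{u}) (G : Type u) [Group G] [Finite G] :
    Monotone (normSeries X F G) :=
  monotone_nat_of_le_succ fun i => (QuotientGroup.ker_mk' _).ge.trans
    ((QuotientGroup.mk' _).ker_le_comap (norm X F (G ⧸ normSeries X F G i)))

theorem radical_le_norm (X F : GroupClass.{u}) (G : Type u) [Group G] [Finite G] :
    X.radical G ≤ norm X F G :=
  le_iInf fun _ => le_sup_right.trans Subgroup.le_normalizer

theorem IsFormation.centralizer_residual_le_norm (hF : F.IsFormation) (hS : F.IsSubgroupClosed)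
    (X : GroupClass.{u}) : Subgroup.centralizer (F.residual G) ≤ norm X F G :=
  le_iInf fun K => (le_inf
    ((Subgroup.centralizer_le (hF.subgroupResidual_le_residual hS K)).trans
      (Subgroup.centralizer_le_normalizer _))
    (Subgroup.normalizer_eq_top (X.radical G) ▸ le_top)).trans
      (Subgroup.normalizer_inf_normalizer_le_normalizer_sup _ _)

theorem IsHypercentral.factor_le_norm (hF : F.IsFormation) (hS : F.IsSubgroupClosed)
    {N T L : Subgroup G} [T.Normal] (hN : IsHypercentral π (nilpotent.formationProduct F) N)
    (hc : IsChiefFactor (N ⊓ T) L) (hLN : L ≤ N) :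
    factor T L ≤ norm (piGroups πᶜ) F (G ⧸ T) := by
  have := hc.normal_bot
  have := hc.normal_top
  by_cases hp : ∃ p ∈ π, (p : ℕ) ∣ Nat.card (factor (N ⊓ T) L)
  · refine le_trans ?_ (hF.centralizer_residual_le_norm hS _)
    rw [← hF.map_residual hS _ (QuotientGroup.mk'_surjective T), factor_le_centralizer_iff]
    exact (le_ker_factorAction_iff.1 (((isHypercentral_iff hF hS).1 hN).2 _ _ hc hLN hp)).trans
      inf_le_right
  · refine (le_sSup ?_).trans (radical_le_norm (piGroups πᶜ) F (G ⧸ T))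
    refine ⟨inferInstance, fun p hpd hpπ => hp ⟨p, hpπ, hpd.trans ?_⟩⟩
    rw [card_factor, card_factor]
    exact Subgroup.relIndex_dvd_of_le_left L inf_le_right

theorem IsHypercentral.le_piNormInfty (hF : F.IsFormation) (hS : F.IsSubgroupClosed)
    {N : Subgroup G} (hN : IsHypercentral π (nilpotent.formationProduct F) N) :
    N ≤ piNormInfty πᶜ F G := by
  obtain ⟨i, hi⟩ := WellFoundedGT.monotone_chain_condition
    ⟨normSeries (piGroups πᶜ) F G, normSeries_mono _ _ _⟩
  let T := normSeries (piGroups πᶜ) F G i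
  refine le_trans ?_ (le_iSup (normSeries (piGroups πᶜ) F G) i)
  by_contra hle
  have := hN.1
  obtain ⟨L, hc, hLN⟩ := exists_isChiefFactor_above (M := N ⊓ T) inferInstance hN.1
    (inf_lt_left.2 hle)
  refine hc.lt.not_ge (le_inf hLN ?_)
  exact (Subgroup.map_le_iff_le_comap.1 (hN.factor_le_norm hF hS hc hLN)).trans
    (hi (i + 1) i.le_succ).ge

theorem isHypercentral_norm (hF : F.IsFormation) (hS : F.IsSubgroupClosed)
    (h3 : BoundaryConditionIII π F) :
    IsHypercentral π (nilpotent.formationProduct F) (norm (piGroups πᶜ) F G) := by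
  rw [isHypercentral_iff hF hS]
  refine ⟨inferInstance, ?_⟩
  rintro K L _ _ hc hL ⟨p, hp, hd⟩
  refine hc.residual_le_ker hF hS h3 hp hd fun H hH => ?_
  have := Fact.mk p.2
  let O := (piGroups πᶜ).radical G
  refine ⟨F.subgroupResidual H ⊔ O, le_sup_left, ?_, hL.trans (iInf_le _ H)⟩
  refine IsPNilpotent.of_map_of_not_dvd_card_ker (QuotientGroup.mk' O) ?_ ?_
  · rw [QuotientGroup.ker_mk']
    exact fun hpO => piGroups_radical_mem πᶜ G p hpO hp
  · rw [map_mk'_sup, hF.map_subgroupResidual hS]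
    exact piNilpotent_formationProduct_mem_iff.1
      (hF.piNilpotent_formationProduct_map hS _ hH) p hp

theorem isHypercentral_normSeries (hF : F.IsFormation) (hS : F.IsSubgroupClosed)
    (h3 : BoundaryConditionIII π F) (i : ℕ) :
    IsHypercentral π (nilpotent.formationProduct F) (normSeries (piGroups πᶜ) F G i) := by
  induction i with
  | zero => exact ⟨inferInstance, fun K L _ _ hc hL _ => absurd (hL.trans bot_le) hc.lt.not_ge⟩
  | succ i ih =>
    refine (isHypercentral_maximalInter hF hS h3).mono inferInstance
      (le_maximalInter_of_forall_sup_mem fun U hU => ih.mem_of_map hF hS ?_)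
    rw [Subgroup.map_sup, normSeries_succ,
      Subgroup.map_comap_eq_self_of_surjective (QuotientGroup.mk'_surjective _)]
    exact (isHypercentral_norm hF hS h3).mem_sup hF hS
      (hF.piNilpotent_formationProduct_map hS _ hU)

theorem piNormInfty_le_maximalInter (hF : F.IsFormation) (hS : F.IsSubgroupClosed)
    (h3 : BoundaryConditionIII π F) :
    piNormInfty πᶜ F G ≤ ((piNilpotent π).formationProduct F).maximalInter G :=
  iSup_le fun i => (isHypercentral_normSeries hF hS h3 i).le_maximalInter hF hS

end Norm

end GroupClass

section ExistsIrreducible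

variable {p : ℕ} [Fact p.Prime]

open MonoidAlgebra in
theorem exists_isMaximal_of_sub_one_notMem (k : Type*) [Field k] [CharP k p] {G : Type*} [Group G]
    [Finite G] {g : G} (hg : ∀ n, g ^ p ^ n ≠ 1) :
    ∃ I : Ideal k[G], I.IsMaximal ∧ of k G g - 1 ∉ I := by
  have : IsArtinianRing k[G] := IsArtinianRing.of_finite k _
  have : CharP k[G] p := charP_of_injective_algebraMap (algebraMap k _).injective p
  -- Otherwise `g - 1` lies in the nilpotent Jacobson radical, so that
  -- `g ^ p ^ n - 1 = (g - 1) ^ p ^ n = 0` for some `n`.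
  by_contra! h
  have hmem : of k G g - 1 ∈ (⊥ : Ideal k[G]).jacobson :=
    Ideal.mem_sInf.2 fun {I} hI => h I hI.2
  obtain ⟨n, hn⟩ := IsArtinianRing.isNilpotent_jacobson_bot (R := k[G])
  have hpow : (of k G g - 1) ^ p ^ n = 0 := by
    refine pow_eq_zero_of_le (Nat.lt_pow_self (Fact.out : p.Prime).one_lt).le ?_
    have := Ideal.pow_mem_pow hmem n
    rwa [hn] at this
  rw [sub_pow_char_pow_of_commute p n (Commute.one_right _), one_pow, sub_eq_zero, ← map_pow,
    ← map_one (of k G)] at hpow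
  exact hg n (of_injective hpow)

open MonoidAlgebra in
theorem exists_actsIrreducibly {G : Type u} [Group G] [Finite G] {g : G}
    (hg : ∀ n, g ^ p ^ n ≠ 1) :
    ∃ (V : Type u) (_ : CommGroup V) (_ : Finite V) (φ : G →* MulAut V),
      IsPGroup p V ∧ ActsIrreducibly φ ∧ φ g ≠ 1 := by
  obtain ⟨I, hI, hgI⟩ := exists_isMaximal_of_sub_one_notMem (ZMod p) hg
  let R := (ZMod p)[G]
  let M := R ⧸ I
  have : IsSimpleModule R M := isSimpleModule_iff_isCoatom.2 hI.out
  have : Finite R := Module.finite_of_finite (ZMod p)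
  have : Finite M := I.toAddSubgroup.finite_quotient_of_finiteIndex
  let φ : G →* MulAut (Multiplicative M) := (MulAutMultiplicative M).symm.toMonoidHom.comp
    ((DistribMulAction.toAddAut Rˣ M).comp (of (ZMod p) G).toHomUnits)
  refine ⟨Multiplicative M, inferInstance, inferInstance, φ, ZModModule.isPGroup_multiplicative,
    fun B hB => ?_, fun h => hgI ?_⟩
  · let N : Submodule R M := submoduleOfSMulMem
      (AddSubgroup.toZModSubmodule p (Subgroup.toAddSubgroup' B)) hB
    obtain hN | hN := eq_bot_or_eq_top N
    · exact .inl (SetLike.ext' (congrArg (fun N : Submodule R M => (N : Set M)) hN))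
    · exact .inr (SetLike.ext' (congrArg (fun N : Submodule R M => (N : Set M)) hN))
  · have hg1 : Submodule.Quotient.mk (p := I) (of (ZMod p) G g * 1) = Submodule.Quotient.mk 1 :=
      DFunLike.congr_fun h (Multiplicative.ofAdd (Submodule.Quotient.mk 1))
    rwa [mul_one, Submodule.Quotient.eq] at hg1

end ExistsIrreducible

section FaithfulSemidirect

variable {V A : Type*} [CommGroup V] [Group A] {φ : A →* MulAut V}

theorem ker_semidirectConj_le (hφ : Function.Injective φ) :
    (semidirectConj φ).ker ≤ (SemidirectProduct.inl : V →* V ⋊[φ] A).range := by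
  intro x hx
  rw [SemidirectProduct.range_inl_eq_ker_rightHom, MonoidHom.mem_ker]
  have hconj : MulAut.conj x.left = 1 := by ext; simp
  have hx' : MulAut.conj x.left * φ x.right = 1 := hx
  rw [hconj, one_mul] at hx'
  exact (map_eq_one_iff φ hφ).1 hx'

theorem ActsIrreducibly.range_inl_le (h : ActsIrreducibly φ) (hφ : Function.Injective φ)
    {M : Subgroup (V ⋊[φ] A)} [M.Normal] (hM : M ≠ ⊥) :
    (SemidirectProduct.inl : V →* V ⋊[φ] A).range ≤ M := by
  refine (h.disjoint_or_range_inl_le M).resolve_left fun hdis => hM ?_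
  have hcomm : ⁅M, (SemidirectProduct.inl : V →* V ⋊[φ] A).range⁆ = ⊥ :=
    disjoint_iff_inf_le.1 hdis |> (Subgroup.commutator_le_inf _ _).trans |> le_bot_iff.1
  rw [Subgroup.commutator_eq_bot_iff_le_centralizer, ← ker_semidirectConj] at hcomm
  exact disjoint_self.1 (hdis.mono_right (hcomm.trans (ker_semidirectConj_le hφ)))

end FaithfulSemidirect

namespace GroupClass

section NormFunctoriality

variable {F : GroupClass.{u}} {π : Set Nat.Primes} {G H : Type u} [Group G] [Finite G] [Group H]
  [Finite H] {f : G →* H}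

theorem map_radical_piGroups_le (hf : Function.Surjective f) :
    ((piGroups π).radical G).map f ≤ (piGroups π).radical H :=
  le_sSup ⟨Subgroup.Normal.map inferInstance f hf, piGroups_mem_map f (piGroups_radical_mem π G)⟩

theorem IsFormation.map_norm_le (hF : F.IsFormation) (hS : F.IsSubgroupClosed)
    (hf : Function.Surjective f) :
    (norm (piGroups π) F G).map f ≤ norm (piGroups π) F H := by
  refine le_iInf fun K => ?_
  let O := (piGroups π).radical H
  have hsup : (F.subgroupResidual (K.comap f) ⊔ (piGroups π).radical G).map f ⊔ O =
      F.subgroupResidual K ⊔ O := by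
    rw [Subgroup.map_sup, hF.map_subgroupResidual hS, Subgroup.map_comap_eq_self_of_surjective hf,
      sup_assoc, sup_eq_right.2 (map_radical_piGroups_le hf)]
  rw [← hsup]
  refine le_trans (le_inf ?_ ?_) (Subgroup.normalizer_inf_normalizer_le_normalizer_sup _ _)
  · exact (Subgroup.map_mono (iInf_le _ (K.comap f))).trans (Subgroup.le_normalizer_map f)
  · exact Subgroup.normalizer_eq_top O ▸ le_top

theorem IsFormation.normSeries_le_comap (hF : F.IsFormation) (hS : F.IsSubgroupClosed)
    (hf : Function.Surjective f) (i : ℕ) :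
    normSeries (piGroups π) F G i ≤ (normSeries (piGroups π) F H i).comap f := by
  induction i with
  | zero => exact bot_le
  | succ i ih =>
    rw [normSeries_succ, normSeries_succ]
    refine Subgroup.comap_mono (Subgroup.map_le_iff_le_comap.1 (hF.map_norm_le hS ?_) :
      _ ≤ (norm _ F _).comap (QuotientGroup.map _ _ f ih))
    exact QuotientGroup.map_surjective_of_surjective _ _ f
      ((QuotientGroup.mk'_surjective _).comp hf) ih

theorem IsFormation.piNormInfty_le_comap (hF : F.IsFormation) (hS : F.IsSubgroupClosed)
    (hf : Function.Surjective f) : piNormInfty π F G ≤ (piNormInfty π F H).comap f :=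
  iSup_le fun i => (hF.normSeries_le_comap hS hf i).trans (Subgroup.comap_mono (le_iSup _ i))

theorem IsFormation.piNormInfty_eq_bot (hF : F.IsFormation) (hS : F.IsSubgroupClosed)
    (h : norm (piGroups π) F G = ⊥) : piNormInfty π F G = ⊥ := by
  refine iSup_eq_bot.2 fun i => ?_
  induction i with
  | zero => rfl
  | succ i ih =>
    let f := QuotientGroup.lift (normSeries (piGroups π) F G i) (MonoidHom.id G) ih.le
    have hf : Function.Surjective f := fun g => ⟨QuotientGroup.mk g, rfl⟩
    refine eq_bot_iff.2 fun g hg => h ▸ hF.map_norm_le hS hf ⟨QuotientGroup.mk g, hg, rfl⟩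

end NormFunctoriality

section Counterexample

variable {F : GroupClass.{u}} {π : Set Nat.Primes} {p : Nat.Primes} {G V : Type u} [Group G]
  [Finite G] [CommGroup V] [Finite V] {φ : G →* MulAut V}

theorem radical_semidirectProduct_eq_bot (hφ : ActsIrreducibly φ) (hinj : Function.Injective φ)
    (hp : p ∈ π) (hV : (p : ℕ) ∣ Nat.card V) : (piGroups πᶜ).radical (V ⋊[φ] G) = ⊥ := by
  by_contra hne
  refine piGroups_radical_mem πᶜ (V ⋊[φ] G) p (hV.trans ?_) hp
  rw [Nat.card_congr (MonoidHom.ofInjective (SemidirectProduct.inl_injective (φ := φ))).toEquiv]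
  exact Subgroup.card_dvd_of_le (hφ.range_inl_le hinj hne)

theorem IsFormation.norm_semidirectProduct_eq_bot (hF : F.IsFormation) (hS : F.IsSubgroupClosed)
    (hφ : ActsIrreducibly φ) (hinj : Function.Injective φ) (hp : p ∈ π)
    (hV : (p : ℕ) ∣ Nat.card V) (hG : F.residual G ≠ ⊥) :
    norm (piGroups πᶜ) F (V ⋊[φ] G) = ⊥ := by
  by_contra hne
  refine hG (eq_bot_iff.2 fun s hs => (map_eq_one_iff φ hinj).1 ?_)
  ext v
  let x : V ⋊[φ] G := SemidirectProduct.inl v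
  let t : V ⋊[φ] G := SemidirectProduct.inr s
  have hnorm : x ∈ Subgroup.normalizer ((F.residual G).map (SemidirectProduct.inr (φ := φ)) :
      Set (V ⋊[φ] G)) := by
    have := Subgroup.mem_iInf.1 (hφ.range_inl_le hinj hne ⟨v, rfl⟩) SemidirectProduct.inr.range
    rwa [radical_semidirectProduct_eq_bot hφ hinj hp hV, sup_bot_eq,
      hF.subgroupResidual_range hS] at this
  obtain ⟨r, -, hr : SemidirectProduct.inr r = x * t * x⁻¹⟩ :=
    (Subgroup.mem_normalizer_iff.1 hnorm t).1 ⟨s, hs, rfl⟩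
  have hleft : 1 = v * (φ s v)⁻¹ := by simpa [x, t] using congrArg SemidirectProduct.left hr
  exact (mul_inv_eq_one.1 hleft.symm).symm

theorem IsFormation.disjoint_piNormInfty_range_inl (hF : F.IsFormation)
    (hS : F.IsSubgroupClosed) (hφ : ActsIrreducibly φ) (hp : p ∈ π) (hV : IsPGroup p V)
    (hG : ¬ F.residual G ≤ φ.ker) :
    Disjoint (piNormInfty πᶜ F (V ⋊[φ] G)) (SemidirectProduct.inl : V →* V ⋊[φ] G).range := by
  have := Fact.mk p.2
  have hVp : (p : ℕ) ∣ Nat.card V := by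
    refine hV.card_eq_or_dvd.resolve_left fun h1 => hG fun s _ => ?_
    have := (Nat.card_eq_one_iff_unique.1 h1).1
    ext v
    exact Subsingleton.elim _ _
  have hφ' : ActsIrreducibly φ.range.subtype := fun B hB => hφ B fun g => hB ⟨φ g, g, rfl⟩
  have hres : F.residual φ.range ≠ ⊥ := by
    rwa [← hF.map_residual hS φ.rangeRestrict φ.rangeRestrict_surjective, Ne,
      Subgroup.map_eq_bot_iff, φ.ker_rangeRestrict]
  let ψ : V ⋊[φ] G →* V ⋊[φ.range.subtype] φ.range :=
    SemidirectProduct.map (MonoidHom.id V) φ.rangeRestrict fun _ => rfl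
  have hψ : Function.Surjective ψ := by
    rintro ⟨v, a⟩
    obtain ⟨g, rfl⟩ := φ.rangeRestrict_surjective a
    exact ⟨⟨v, g⟩, rfl⟩
  have hker : piNormInfty πᶜ F (V ⋊[φ] G) ≤ ψ.ker := by
    rw [← MonoidHom.comap_bot, ← hF.piNormInfty_eq_bot hS (hF.norm_semidirectProduct_eq_bot hS hφ'
      φ.range.subtype_injective hp hVp hres)]
    exact hF.piNormInfty_le_comap hS hψ
  rw [Subgroup.disjoint_def]
  rintro _ hx ⟨v, rfl⟩
  have hv : v = 1 := congrArg SemidirectProduct.left (MonoidHom.mem_ker.1 (hker hx))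
  rw [hv, map_one]

theorem range_inl_le_maximalInter (hF : F.IsFormation) (hS : F.IsSubgroupClosed)
    (hG : IsCritical ((piGroups {p}).formationProduct F) G)
    (hGX : ¬ ((piNilpotent π).formationProduct F).Mem G) (hV : IsPGroup p V) :
    (SemidirectProduct.inl : V →* V ⋊[φ] G).range ≤
      ((piNilpotent π).formationProduct F).maximalInter (V ⋊[φ] G) := by
  refine le_maximalInter_of_forall_sup_mem fun U hU => ?_
  let r : V ⋊[φ] G →* G := SemidirectProduct.rightHom
  let B : Subgroup (V ⋊[φ] G) := SemidirectProduct.inl.range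
  have hBr : B = r.ker := SemidirectProduct.range_inl_eq_ker_rightHom
  have hUr : U.map r < ⊤ := by
    refine lt_top_iff_ne_top.2 fun htop => hGX ?_
    exact GroupClass.mem_of_mulEquiv _ Subgroup.topEquiv
      (htop ▸ hF.piNilpotent_formationProduct_map hS r hU)
  have hres : F.subgroupResidual (U ⊔ B) ≤ (F.subgroupResidual (U.map r)).comap r := by
    rw [← Subgroup.map_le_iff_le_comap, hF.map_subgroupResidual hS, Subgroup.map_sup,
      (Subgroup.map_eq_bot_iff B).2 hBr.le, sup_bot_eq]
  have := Fact.mk p.2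
  have hker : IsPGroup p r.ker :=
    hBr ▸ hV.of_surjective _ (MonoidHom.rangeRestrict_surjective _)
  have hpU := piGroups_formationProduct_mem_iff.1 (hG.2 _ hUr)
  have hnil := ((hpU.comap_of_ker_isPGroup r hker).to_le hres).isNilpotent
  refine piNilpotent_formationProduct_mem_iff.2 fun q _ => ?_
  have := Fact.mk q.2
  exact .of_isNilpotent

theorem exists_not_maximalInter_le_of_not_boundaryConditionIII (hF : F.IsFormation)
    (hS : F.IsSubgroupClosed) (h : ¬ BoundaryConditionIII π F) :
    ∃ (W : Type u) (_ : Group W) (_ : Finite W),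
      ¬ ((piNilpotent π).formationProduct F).maximalInter W ≤ piNormInfty πᶜ F W := by
  simp only [BoundaryConditionIII, not_forall] at h
  obtain ⟨p, hp, G, _, _, hcrit, hGX⟩ := h
  have := Fact.mk p.2
  obtain ⟨⟨g, hgR⟩, hg⟩ : ∃ g : F.residual G, ∀ n, g ^ (p : ℕ) ^ n ≠ 1 := by
    simpa [IsPGroup] using (piGroups_singleton_mem_iff p).not.1 hcrit.1
  obtain ⟨V, _, _, φ, hV, hφ, hφg⟩ :=
    exists_actsIrreducibly fun n hn => hg n (Subtype.ext hn)
  refine ⟨V ⋊[φ] G, inferInstance, inferInstance, fun hle => hφg ?_⟩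
  have hle' := (range_inl_le_maximalInter hF hS hcrit hGX hV).trans hle
  have hdis := hF.disjoint_piNormInfty_range_inl hS hφ hp hV fun hR => hφg (hR hgR)
  ext v
  have hv : v = 1 := SemidirectProduct.inl_injective
    ((Subgroup.disjoint_def.1 hdis (hle' ⟨v, rfl⟩) ⟨v, rfl⟩).trans (map_one _).symm)
  rw [hv, map_one, map_one]

end Counterexample

end GroupClass

theorem theoremC (π : Set Nat.Primes) (F : GroupClass.{u}) (hF : F.IsFormation)
    (hS : F.IsSubgroupClosed) :
    List.TFAE [
      ∀ (G : Type u) [Group G] [Finite G],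
        GroupClass.piNormInfty πᶜ F G =
          ((GroupClass.piNilpotent π).formationProduct F).maximalInter G,
      ∀ (G : Type u) [Group G] [Finite G],
        GroupClass.hypercentre π (GroupClass.nilpotent.formationProduct F) G =
          ((GroupClass.piNilpotent π).formationProduct F).maximalInter G,
      GroupClass.BoundaryConditionIII π F] := by
  tfae_have 1 → 3 := by
    intro h
    by_contra h3
    obtain ⟨W, _, _, hW⟩ :=
      GroupClass.exists_not_maximalInter_le_of_not_boundaryConditionIII hF hS h3
    exact hW (h W).ge
  tfae_have 2 → 3 := by
    intro h
    by_contra h3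
    obtain ⟨W, _, _, hW⟩ :=
      GroupClass.exists_not_maximalInter_le_of_not_boundaryConditionIII hF hS h3
    exact hW ((h W).ge.trans (sSup_le fun N hN => hN.le_piNormInfty hF hS))
  tfae_have 3 → 1 := fun h G _ _ =>
    le_antisymm (GroupClass.piNormInfty_le_maximalInter hF hS h)
      ((GroupClass.isHypercentral_maximalInter hF hS h).le_piNormInfty hF hS)
  tfae_have 3 → 2 := fun h G _ _ =>
    le_antisymm (sSup_le fun N hN => hN.le_maximalInter hF hS)
      (le_sSup (GroupClass.isHypercentral_maximalInter hF hS h))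
  tfae_finish
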